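/- Let $\mathcal X,\mathcal Y$ be finite sets and let logarithms be natural. For a sequence $\mathbf z\in\mathcal A^n$ its type is the empirical distribution $a\mapsto \frac1n|\{i:z_i=a\}|$; an $n$-type is the type of some sequence of length $n$, and the type class $\mathcal T^{(n)}_T$ is the set of sequences of length $n$ with type $T$. Let $n\ge 1$ and let $T_{XY}$ be a joint $n$-type on $\mathcal X\times\mathcal Y$ with marginals $T_X,T_Y$. The type graph is the bipartite graph with sides $\mathcal T^{(n)}_{T_X}$ and $\mathcal T^{(n)}_{T_Y}$, in which $\mathbf x,\mathbf y$ are adjacent iff $(\mathbf x,\mathbf y)\in\mathcal T^{(n)}_{T_{XY}}$. For $1\le M_1\le|\mathcal T^{(n)}_{T_X}|$ and $1\le M_2\le|\mathcal T^{(n)}_{T_Y}|$ let $$\Gamma_n(M_1,M_2)=\max_{A\subseteq\mathcal T^{(n)}_{T_X},\,B\subseteq\mathcal T^{(n)}_{T_Y},\,|A|=M_1,\,|B|=M_2}\frac{|(A\times B)\cap\mathcal T^{(n)}_{T_{XY}}|}{|A||B|}.$$ Let $\mathcal R_X^{(n)}=\{\frac1n\log M: 1\le M\le|\mathcal T^{(n)}_{T_X}|\}$,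 define $\mathcal R_Y^{(n)}$ likewise, and for $(R_1,R_2)\in\mathcal R_X^{(n)}\times\mathcal R_Y^{(n)}$ let $E_n(R_1,R_2)=-\frac1n\log\Gamma_n(e^{nR_1},e^{nR_2})$. Since $T_{XY}$ is also a $kn$-type for every $k\ge1$, $E_{kn}(R_1,R_2)$ is defined as well; put $E(R_1,R_2)=\lim_{k\to\infty}E_{kn}(R_1,R_2)$. For $R_1,R_2\ge0$ let $$F^*(R_1,R_2)=\max\{H(XY|W): P_{XYW},\ P_{XY}=T_{XY},\ H(X|W)\le R_1,\ H(Y|W)\le R_2\},$$ where $W$ ranges over random variables with an arbitrary finite alphabet $\mathcal W$, and let $E^*(R_1,R_2)=R_1+R_2-F^*(R_1,R_2)$. Then: 1. If $n\ge 2(|\mathcal X||\mathcal Y|+2)|\mathcal X||\mathcal Y|$, then for all $(R_1,R_2)\in\mathcal R_X^{(n)}\times\mathcal R_Y^{(n)}$, $$E^*(R_1,R_2)\le E_n(R_1,R_2)\le E^*(R_1,R_2)+\varepsilon_n,\qquad \varepsilon_n=\frac{(|\mathcal X||\mathcal Y|+2)|\mathcal X||\mathcal Y|}{n}\log\frac{(n+1)n^6}{|\mathcal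 X|^4|\mathcal Y|^4};$$ here $\varepsilon_n=O(\frac{\log n}{n})$ as $n\to\infty$, for fixed $|\mathcal X|,|\mathcal Y|$. 2. For any $n\ge1$, any joint $n$-type $T_{XY}$ and all $(R_1,R_2)\in\mathcal R_X^{(n)}\times\mathcal R_Y^{(n)}$, the limit $E(R_1,R_2)$ exists and equals $E^*(R_1,R_2)$. 3. For all $R_1,R_2\ge0$ the maximum defining $F^*(R_1,R_2)$ is attained, and it is attained by some $W$ with $|\mathcal W|\le|\mathcal X||\mathcal Y|+2$. -/

import Mathlib

open Filter Topology Asymptotics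

noncomputable section

namespace TypeGraph

/-! ### Types and type classes -/

open Classical in
/-- The empirical distribution (type) of a sequence of length `n` over the alphabet `A`. -/
def empirical {A : Type*} {n : ℕ} (z : Fin n → A) : A → ℝ :=
  fun a => ((Finset.univ.filter fun i => z i = a).card : ℝ) / n

/-- The type class of `T` in `A ^ n`: the sequences of length `n` whose type is `T`. -/
def typeClass {A : Type*} (n : ℕ) (T : A → ℝ) : Set (Fin n → A) :=
  {z | empirical z = T}

/-- `T` is an `n`-type: the empirical distribution of some sequence of length `n`. -/
def IsNType {A : Type*} (n : ℕ) (T : A → ℝ) : Prop :=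
  ∃ z : Fin n → A, empirical z = T

/-- The first marginal of a joint distribution. -/
def margX {X Y : Type*} [Fintype Y] (T : X × Y → ℝ) : X → ℝ :=
  fun x => ∑ y, T (x, y)

/-- The second marginal of a joint distribution. -/
def margY {X Y : Type*} [Fintype X] (T : X × Y → ℝ) : Y → ℝ :=
  fun y => ∑ x, T (x, y)

variable {X Y : Type*} [Fintype X] [Fintype Y]

/-! ### The type graph, its maximal density and the exponent -/

/-- Adjacency in the type graph: `𝐱` and `𝐲` are joined iff `(𝐱, 𝐲)` has joint type `T`. -/
def typeAdj (n : ℕ) (T : X × Y → ℝ) :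
    typeClass n (margX T) ⊕ typeClass n (margY T) →
      typeClass n (margX T) ⊕ typeClass n (margY T) → Prop
  | .inl x, .inr y => (fun i => (x.1 i, y.1 i)) ∈ typeClass n T
  | .inr y, .inl x => (fun i => (x.1 i, y.1 i)) ∈ typeClass n T
  | .inl _, .inl _ => False
  | .inr _, .inr _ => False

/-- The type graph: the undirected bipartite graph whose two sides are the type classes
of the two marginals, and whose edges are given by the joint type class. -/
def typeGraph (n : ℕ) (T : X × Y → ℝ) :
    SimpleGraph (typeClass n (margX T) ⊕ typeClass n (margY T)) where
  Adj := typeAdj n T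
  symm := ⟨by
    rintro (a | a) (b | b) h
    · exact h.elim
    · exact h
    · exact h
    · exact h.elim⟩
  loopless := ⟨by
    rintro (a | a) h
    · exact h.elim
    · exact h.elim⟩

open Classical in
/-- The edge density of the subgraph induced by `A` and `B`: the number of edges between
`A` and `B`, divided by `|A| |B|`. -/
def density (n : ℕ) (T : X × Y → ℝ)
    (A : Finset (typeClass n (margX T))) (B : Finset (typeClass n (margY T))) : ℝ :=
  ((typeGraph n T).edgeDensity (A.map .inl) (B.map .inr) : ℚ)

/-- The maximal density of induced subgraphs with `M₁` and `M₂` vertices on the two sides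
(the arguments are real numbers, used only for positive integers for which such subsets exist;
the supremum is then over a finite nonempty set, hence a maximum). -/
def maxDensity (n : ℕ) (T : X × Y → ℝ) (M₁ M₂ : ℝ) : ℝ :=
  sSup {ρ : ℝ | ∃ (A : Finset (typeClass n (margX T))) (B : Finset (typeClass n (margY T))),
    (A.card : ℝ) = M₁ ∧ (B.card : ℝ) = M₂ ∧ density n T A B = ρ}

/-- The rates `(1 / n) log M` with `M` an integer between `1` and the size of the type class
of `S`. -/
def rates {A : Type*} (n : ℕ) (S : A → ℝ) : Set ℝ :=
  {R | ∃ M : ℕ, 1 ≤ M ∧ M ≤ (typeClass n S).ncard ∧ R = 1 / (n : ℝ) * Real.log M}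

/-- The exponent of maximal density `Eₙ(R₁, R₂) = -(1 / n) log Γₙ(exp (n R₁), exp (n R₂))`. -/
def exponent (n : ℕ) (T : X × Y → ℝ) (R₁ R₂ : ℝ) : ℝ :=
  -(1 / (n : ℝ)) * Real.log (maxDensity n T (Real.exp (n * R₁)) (Real.exp (n * R₂)))

/-! ### The single-letter exponent -/

/-- The conditional entropy `H(A | W) = -∑ Q(a, w) log Q(a | w)` (natural logarithm) of a joint
distribution `Q` of `(A, W)`; terms with `Q(a, w) = 0` vanish. -/
def condEntropy {A W : Type*} [Fintype A] [Fintype W] (Q : A → W → ℝ) : ℝ :=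
  -∑ w, ∑ a, Q a w * Real.log (Q a w / ∑ a', Q a' w)

/-- `P` is the joint distribution of a triple `(X, Y, W)`, with `(X, Y)` distributed as `T`,
`H(X | W) ≤ R₁` and `H(Y | W) ≤ R₂`. -/
def Feasible {W : Type*} [Fintype W] (T : X × Y → ℝ) (R₁ R₂ : ℝ) (P : X × Y × W → ℝ) : Prop :=
  P ∈ stdSimplex ℝ (X × Y × W) ∧
  (∀ x y, ∑ w, P (x, y, w) = T (x, y)) ∧
  condEntropy (fun x w => ∑ y, P (x, y, w)) ≤ R₁ ∧
  condEntropy (fun y w => ∑ x, P (x, y, w)) ≤ R₂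

/-- The values of `H(X Y | W)` over feasible triples with `W` in an alphabet of size `m`. -/
def entropyValues (T : X × Y → ℝ) (R₁ R₂ : ℝ) (m : ℕ) : Set ℝ :=
  {h | ∃ P : X × Y × Fin m → ℝ, Feasible T R₁ R₂ P ∧
    condEntropy (fun (z : X × Y) w => P (z.1, z.2, w)) = h}

/-- `F*(R₁, R₂)`: the maximum of `H(X Y | W)` over feasible triples, with `W` in an
arbitrary finite alphabet. -/
def FStar (T : X × Y → ℝ) (R₁ R₂ : ℝ) : ℝ :=
  sSup (⋃ m : ℕ, entropyValues T R₁ R₂ m)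

/-- `E*(R₁, R₂) = R₁ + R₂ - F*(R₁, R₂)`. -/
def EStar (T : X × Y → ℝ) (R₁ R₂ : ℝ) : ℝ :=
  R₁ + R₂ - FStar T R₁ R₂

/-- The error term `εₙ`, for alphabets of sizes `a` and `b`. -/
def errorTerm (a b n : ℕ) : ℝ :=
  (((a : ℝ) * b + 2) * a * b / n) *
    Real.log (((n : ℝ) + 1) * (n : ℝ) ^ 6 / ((a : ℝ) ^ 4 * (b : ℝ) ^ 4))

end TypeGraph

end

/-!
The theorem rests on one quantity, `massEntropy v = -∑ v a log (v a / |v|)`, the entropy of a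
measure of arbitrary mass, homogeneous of degree one. A conditional entropy `H(A | W)` is the sum of
the entropies of the columns of the joint distribution, and most facts about it become facts about
columns: the chain rule is an identity, conditioning reduces entropy because `massEntropy` is
superadditive, and reweighting a column scales its contribution.

The maximum in `FStar` exists over each finite alphabet by compactness. A triple with more than
`|X| |Y| + 2` columns can be improved: the column weights solve `|X| |Y| + 2` linear equations (the
law of `(X, Y)` and the values of `H(X | W)` and `H(Y | W)`), so they can be moved along a line on
which the objective `H(X Y | W)` does not decrease until a column disappears
(`Feasible.exists_card_pred`). Since the problem is linear in the weights and the objective is one of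
the linear functionals, no connectedness argument is needed for the bound `|X| |Y| + 2`.

The inequality `EStar ≤ exponent` is exact. Draw an edge between `A` and `B` uniformly, draw a
position `J` uniformly, and let `W` be `J` with the two prefixes before it. The pair of letters at `J`
has law `T`, because every edge has joint type `T`; the chain rule gives
`n H(X Y | W) = log (number of edges)`, and `n H(X | W) ≤ log |A|`, as `W` conditions on more than the
prefix of the first sequence (`exists_single_letter`, `log_card_le_mul_FStar`).

For the reverse inequality an optimal `W` with `|X| |Y| + 2` symbols is rounded so that `n P(x, y, w)`
becomes an integral array with the same `(X, Y)`-marginal, and realised by a sequence of triples.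
The conditional type classes of its `X`- and `Y`-parts given the `W`-part have at most
`exp (n H(X | W))` and `exp (n H(Y | W))` elements (`log_card_condClass_le`) and contain at least
`(n + 1) ^ (-|X| |Y| |W|) exp (n H(X Y | W))` edges (`condEntropy_sub_le_log_card_condClass`).
Enlarging these sets, or keeping their vertices of largest degree, produces the prescribed sizes
(`log_card_edges_le`). Rounding moves each cell by at most `1 / n`, and the modulus of continuity
`|η s - η t| ≤ η |s - t|` of `η t = -t log t` bounds the change of the three conditional entropies
(`abs_condEntropy_sub_le`). Adding these changes to the counting loss gives `errorTerm` exactly. The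
limit follows by applying both bounds to the lengths `k n`.
-/

namespace TypeGraph

open Real

/-! ### Entropy of unnormalised measures -/

/-- The entropy of a finite measure `v` that need not have mass one, made homogeneous of degree
one: `-∑ v a log (v a / |v|)`, where `|v|` is the total mass. The conditional entropy `H(A | W)`
is the sum of these quantities over the columns of the joint distribution. -/
noncomputable def massEntropy {A : Type*} [Fintype A] (v : A → ℝ) : ℝ :=
  ∑ a, negMulLog (v a) - negMulLog (∑ a, v a)

section

variable {A B ι : Type*} [Fintype A] [Fintype B] [Fintype ι]

lemma massEntropy_eq_neg_sum {v : A → ℝ} (hv : ∀ a, 0 ≤ v a) :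
    massEntropy v = -∑ a, v a * log (v a / ∑ a', v a') := by
  have h : ∀ a, v a * log (v a / ∑ a', v a') = v a * log (v a) - v a * log (∑ a', v a') := by
    intro a
    rcases (hv a).eq_or_lt with h0 | h0
    · simp [← h0]
    · have : 0 < ∑ a', v a' :=
        h0.trans_le (Finset.single_le_sum (fun i _ => hv i) (Finset.mem_univ a))
      rw [log_div h0.ne' this.ne', mul_sub]
  simp only [h, Finset.sum_sub_distrib, ← Finset.sum_mul, massEntropy, negMulLog,
    neg_mul, Finset.sum_neg_distrib]
  ring

lemma condEntropy_eq_sum_massEntropy {Q : A → B → ℝ} (hQ : ∀ a w, 0 ≤ Q a w) :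
    condEntropy Q = ∑ w, massEntropy (fun a => Q a w) := by
  rw [condEntropy, ← Finset.sum_neg_distrib]
  exact Finset.sum_congr rfl fun w _ => (massEntropy_eq_neg_sum fun a => hQ a w).symm

lemma massEntropy_const_mul (c : ℝ) (v : A → ℝ) :
    massEntropy (fun a => c * v a) = c * massEntropy v := by
  simp only [massEntropy, ← Finset.mul_sum, negMulLog_mul, Finset.sum_add_distrib,
    ← Finset.sum_mul]
  ring

@[fun_prop]
lemma continuous_massEntropy : Continuous (massEntropy : (A → ℝ) → ℝ) := by
  unfold massEntropy
  fun_prop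

@[simp]
lemma massEntropy_zero : massEntropy (fun _ : A => 0) = 0 := by simp [massEntropy]

lemma massEntropy_comp_equiv (e : B ≃ A) (v : A → ℝ) :
    massEntropy (fun b => v (e b)) = massEntropy v := by
  simp only [massEntropy, Equiv.sum_comp e (fun a => negMulLog (v a)), Equiv.sum_comp e v]

lemma massEntropy_eq_zero_of_subsingleton [Subsingleton A] (v : A → ℝ) : massEntropy v = 0 := by
  cases isEmpty_or_nonempty A
  · simp [massEntropy]
  · obtain ⟨a⟩ := ‹Nonempty A›
    have : Unique A := ⟨⟨a⟩, fun b => Subsingleton.elim _ _⟩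
    simp [massEntropy]

/-- The chain rule for the entropy. -/
lemma massEntropy_prod (v : A × B → ℝ) :
    massEntropy v = massEntropy (fun a => ∑ b, v (a, b)) +
      ∑ a, massEntropy (fun b => v (a, b)) := by
  simp only [massEntropy, Fintype.sum_prod_type, Finset.sum_sub_distrib]
  ring

/-- Gibbs' inequality: the cross entropy with respect to a subprobability dominates the
entropy. -/
lemma massEntropy_le_cross {v q : A → ℝ} (hv : ∀ a, 0 ≤ v a) (hq : ∀ a, 0 ≤ q a)
    (hq1 : ∑ a, q a ≤ 1) (h : ∀ a, q a = 0 → v a = 0) :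
    massEntropy v ≤ -∑ a, v a * log (q a) := by
  set V := ∑ a, v a with hV
  have hV0 : 0 ≤ V := Finset.sum_nonneg fun a _ => hv a
  have key : ∀ a, v a * log (q a) - v a * log (v a / V) ≤ q a * V - v a := by
    intro a
    rcases (hv a).eq_or_lt with h0 | h0
    · simp only [← h0, zero_mul, sub_zero]
      exact mul_nonneg (hq a) hV0
    · have hqa : 0 < q a := (hq a).lt_of_ne fun h' => h0.ne' (h a h'.symm)
      have hVp : 0 < V :=
        h0.trans_le (Finset.single_le_sum (fun i _ => hv i) (Finset.mem_univ a))
      have := log_le_sub_one_of_pos (x := q a / (v a / V)) (by positivity)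
      rw [log_div hqa.ne' (by positivity)] at this
      have h2 := mul_le_mul_of_nonneg_left this h0.le
      have h3 : v a * (q a / (v a / V) - 1) = q a * V - v a := by
        field_simp
      linarith
  have hsum := Finset.sum_le_sum fun a (_ : a ∈ Finset.univ) => key a
  rw [Finset.sum_sub_distrib, Finset.sum_sub_distrib, ← Finset.sum_mul, ← hV] at hsum
  rw [massEntropy_eq_neg_sum hv]
  nlinarith [mul_le_mul_of_nonneg_right hq1 hV0]

/-- Superadditivity of the entropy, the unnormalised form of the fact that conditioning reduces
entropy. -/
lemma sum_massEntropy_le {u : ι → A → ℝ} (hu : ∀ i a, 0 ≤ u i a) :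
    ∑ i, massEntropy (u i) ≤ massEntropy (fun a => ∑ i, u i a) := by
  set s : A → ℝ := fun a => ∑ i, u i a with hs
  have hs0 : ∀ a, 0 ≤ s a := fun a => Finset.sum_nonneg fun i _ => hu i a
  have hS0 : 0 ≤ ∑ a, s a := Finset.sum_nonneg fun a _ => hs0 a
  have hle : ∀ i a, u i a ≤ s a := fun i a =>
    Finset.single_le_sum (f := fun i => u i a) (fun j _ => hu j a) (Finset.mem_univ i)
  have hg : ∀ i, massEntropy (u i) ≤ -∑ a, u i a * log (s a / ∑ a', s a') := by
    intro i
    refine massEntropy_le_cross (hu i) (fun a => div_nonneg (hs0 a) hS0) ?_ ?_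
    · rw [← Finset.sum_div]
      exact div_self_le_one _
    · intro a h
      have hsa : s a = 0 := by
        rcases div_eq_zero_iff.mp h with h | h
        · exact h
        · exact (Finset.sum_eq_zero_iff_of_nonneg fun a _ => hs0 a).mp h a (Finset.mem_univ a)
      exact le_antisymm ((hle i a).trans hsa.le) (hu i a)
  refine (Finset.sum_le_sum fun i _ => hg i).trans_eq ?_
  rw [massEntropy_eq_neg_sum hs0, Finset.sum_neg_distrib, Finset.sum_comm]
  simp only [← Finset.sum_mul, hs]

/-- The entropy of a measure carried by a set is at most its mass times the logarithm of the
cardinality of the set. -/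
lemma massEntropy_le_mul_log_card {v : A → ℝ} (hv : ∀ a, 0 ≤ v a) (S : Finset A)
    (hS : ∀ a, a ∉ S → v a = 0) : massEntropy v ≤ (∑ a, v a) * log S.card := by
  classical
  have := massEntropy_le_cross (q := fun a => if a ∈ S then (S.card : ℝ)⁻¹ else 0) hv
    (fun a => by positivity) ?_ ?_
  · refine this.trans_eq ?_
    rw [Finset.sum_mul, ← Finset.sum_neg_distrib]
    refine Finset.sum_congr rfl fun a _ => ?_
    by_cases ha : a ∈ S
    · simp [ha]
    · simp [hS a ha]
  · rw [Finset.sum_ite_mem, Finset.univ_inter, Finset.sum_const, nsmul_eq_mul]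
    exact mul_inv_le_one
  · intro a h
    apply hS
    intro ha
    simp only [ha, if_true, inv_eq_zero, Nat.cast_eq_zero, Finset.card_eq_zero] at h
    simp [h] at ha

/-! ### Continuity of the entropy -/

/-- The modulus of continuity of `negMulLog` on the unit interval. -/
lemma negMulLog_sub_le {s t δ : ℝ} (hs0 : 0 ≤ s) (hs1 : s ≤ 1) (ht0 : 0 ≤ t) (ht1 : t ≤ 1)
    (hδ : δ ≤ exp (-1)) (hst : |s - t| ≤ δ) : negMulLog s - negMulLog t ≤ negMulLog δ := by
  have hδ0 : 0 ≤ δ := (abs_nonneg _).trans hst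
  rcases lt_trichotomy s t with h | rfl | h
  · have hlt : t - s ≤ δ := by rw [abs_sub_comm, abs_of_pos (sub_pos.mpr h)] at hst; exact hst
    have htp : 0 < t := hs0.trans_lt h
    have hδp : 0 < δ := by linarith
    have h1 : negMulLog s - negMulLog t ≤ t - s := by
      have h2 : t * log t ≤ s * log t := by
        nlinarith [log_nonpos ht0 ht1]
      rcases hs0.eq_or_lt with h0 | h0
      · simp only [negMulLog, ← h0]
        nlinarith
      · have h3 := log_le_sub_one_of_pos (x := t / s) (by positivity)
        rw [log_div htp.ne' h0.ne'] at h3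
        have h4 := mul_le_mul_of_nonneg_left h3 h0.le
        have h5 : s * (t / s - 1) = t - s := by field_simp
        simp only [negMulLog]
        nlinarith
    have h6 : log δ ≤ -1 := by
      rw [← log_exp (-1)]
      exact log_le_log hδp hδ
    have h7 : δ ≤ negMulLog δ := by
      simp only [negMulLog]
      nlinarith
    linarith
  · rw [sub_self]
    exact negMulLog_nonneg hδ0 (hδ.trans (by rw [exp_le_one_iff]; norm_num))
  · set τ := s - t with hτ
    have hτp : 0 < τ := by linarith
    have hτδ : τ ≤ δ := by rwa [abs_of_pos hτp] at hst
    have h1 : negMulLog s - negMulLog t ≤ negMulLog τ := by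
      have hsp : 0 < s := by linarith
      have h2 : log τ ≤ log s := log_le_log hτp (by linarith)
      have h3 : t * log t ≤ t * log s := by
        rcases ht0.eq_or_lt with h0 | h0
        · simp [← h0]
        · exact mul_le_mul_of_nonneg_left (log_le_log h0 h.le) ht0
      have h4 := mul_le_mul_of_nonneg_left h2 hτp.le
      have h5 : s = t + τ := by linarith
      have h6 : s * log s = t * log s + τ * log s := by
        conv_lhs => rw [h5]
        rw [add_mul, ← h5]
      simp only [negMulLog]
      linarith
    refine h1.trans ?_
    -- `τ ↦ -τ log τ` is increasing on `[0, 1 / e]`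
    have hδp : 0 < δ := by linarith
    have h6 : log δ ≤ -1 := by
      rw [← log_exp (-1)]
      exact log_le_log hδp hδ
    have h7 := log_le_sub_one_of_pos (x := δ / τ) (by positivity)
    rw [log_div hδp.ne' hτp.ne'] at h7
    have h8 := mul_le_mul_of_nonneg_left h7 hτp.le
    have h9 : τ * (δ / τ - 1) = δ - τ := by field_simp
    simp only [negMulLog]
    nlinarith

lemma abs_negMulLog_sub_le {s t δ : ℝ} (hs0 : 0 ≤ s) (hs1 : s ≤ 1) (ht0 : 0 ≤ t) (ht1 : t ≤ 1)
    (hδ : δ ≤ exp (-1)) (hst : |s - t| ≤ δ) : |negMulLog s - negMulLog t| ≤ negMulLog δ := by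
  rw [abs_le]
  constructor
  · have := negMulLog_sub_le ht0 ht1 hs0 hs1 hδ (by rwa [abs_sub_comm])
    linarith
  · exact negMulLog_sub_le hs0 hs1 ht0 ht1 hδ hst

/-- Continuity of the conditional entropy, with the moduli of the joint distribution and of the
conditioning variable controlled separately. -/
lemma abs_condEntropy_sub_le {P Q : A → B → ℝ} {δ δ' : ℝ}
    (hP : ∀ a w, 0 ≤ P a w) (hQ : ∀ a w, 0 ≤ Q a w)
    (hP1 : ∀ w, ∑ a, P a w ≤ 1) (hQ1 : ∀ w, ∑ a, Q a w ≤ 1)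
    (hδ : δ ≤ exp (-1)) (hδ' : δ' ≤ exp (-1))
    (h : ∀ a w, |P a w - Q a w| ≤ δ) (h' : ∀ w, |∑ a, P a w - ∑ a, Q a w| ≤ δ') :
    |condEntropy P - condEntropy Q| ≤
      Fintype.card A * Fintype.card B * negMulLog δ + Fintype.card B * negMulLog δ' := by
  have hle : ∀ {R : A → B → ℝ}, (∀ a w, 0 ≤ R a w) → (∀ w, ∑ a, R a w ≤ 1) → ∀ a w, R a w ≤ 1 :=
    fun h0 h1 a w => (Finset.single_le_sum (fun i _ => h0 i w) (Finset.mem_univ a)).trans (h1 w)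
  rw [condEntropy_eq_sum_massEntropy hP, condEntropy_eq_sum_massEntropy hQ,
    ← Finset.sum_sub_distrib]
  refine (Finset.abs_sum_le_sum_abs _ _).trans ?_
  have hw : ∀ w, |massEntropy (fun a => P a w) - massEntropy (fun a => Q a w)| ≤
      Fintype.card A * negMulLog δ + negMulLog δ' := by
    intro w
    have e : massEntropy (fun a => P a w) - massEntropy (fun a => Q a w) =
        ∑ a, (negMulLog (P a w) - negMulLog (Q a w)) -
          (negMulLog (∑ a, P a w) - negMulLog (∑ a, Q a w)) := by
      simp only [massEntropy, Finset.sum_sub_distrib]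
      ring
    rw [e]
    refine (abs_sub _ _).trans (add_le_add ?_ ?_)
    · refine (Finset.abs_sum_le_sum_abs _ _).trans ?_
      refine (Finset.sum_le_card_nsmul _ _ (negMulLog δ) fun a _ =>
        abs_negMulLog_sub_le (hP a w) (hle hP hP1 a w) (hQ a w) (hle hQ hQ1 a w) hδ (h a w)).trans ?_
      simp
    · exact abs_negMulLog_sub_le (Finset.sum_nonneg fun a _ => hP a w) (hP1 w)
        (Finset.sum_nonneg fun a _ => hQ a w) (hQ1 w) hδ' (h' w)
  refine (Finset.sum_le_card_nsmul _ _ _ fun w _ => hw w).trans_eq ?_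
  simp only [Finset.card_univ, nsmul_eq_mul]
  ring

end

/-! ### The maximum defining `FStar` -/

section

variable {X Y W W' : Type*} [Fintype X] [Fintype Y] [Fintype W] [Fintype W']
variable {T : X × Y → ℝ} {R₁ R₂ : ℝ}

/-- Columns that vanish do not contribute to the conditional entropy. -/
lemma condEntropy_comp {A : Type*} [Fintype A] {e : W → W'} (he : Function.Injective e)
    (Q : A → W' → ℝ) (hQ : ∀ a w, w ∉ Set.range e → Q a w = 0) :
    condEntropy (fun a w => Q a (e w)) = condEntropy Q := by
  unfold condEntropy
  congr 1
  refine Finset.sum_of_injOn e he.injOn (by simp) (fun w _ hw => ?_) fun w _ => rfl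
  refine Finset.sum_eq_zero fun a _ => ?_
  rw [hQ a w (by simpa using hw), zero_mul]

lemma sum_comp_injective {e : W → W'} (he : Function.Injective e)
    (g : W' → ℝ) (hg : ∀ w, w ∉ Set.range e → g w = 0) : ∑ w, g (e w) = ∑ w, g w :=
  Finset.sum_of_injOn e he.injOn (by simp) (fun w _ hw => hg w (by simpa using hw))
    fun _ _ => rfl

lemma feasible_iff {P : X × Y × W → ℝ} :
    Feasible T R₁ R₂ P ↔ (∀ x y w, 0 ≤ P (x, y, w)) ∧ ∑ z, T z = 1 ∧
      (∀ x y, ∑ w, P (x, y, w) = T (x, y)) ∧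
      ∑ w, massEntropy (fun x => ∑ y, P (x, y, w)) ≤ R₁ ∧
      ∑ w, massEntropy (fun y => ∑ x, P (x, y, w)) ≤ R₂ := by
  have hsum : (∀ x y, ∑ w, P (x, y, w) = T (x, y)) → ∑ z, P z = ∑ z, T z := by
    intro h
    simp only [Fintype.sum_prod_type, h]
  constructor
  · rintro ⟨⟨h0, h1⟩, hT, hX, hY⟩
    rw [condEntropy_eq_sum_massEntropy fun _ _ => Finset.sum_nonneg fun _ _ => h0 _] at hX hY
    exact ⟨fun _ _ _ => h0 _, by rw [← hsum hT, h1], hT, hX, hY⟩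
  · rintro ⟨h0, h1, hT, hX, hY⟩
    refine ⟨⟨fun z => h0 _ _ _, by rw [hsum hT, h1]⟩, hT, ?_, ?_⟩
    · rwa [condEntropy_eq_sum_massEntropy fun _ _ => Finset.sum_nonneg fun _ _ => h0 _ _ _]
    · rwa [condEntropy_eq_sum_massEntropy fun _ _ => Finset.sum_nonneg fun _ _ => h0 _ _ _]

lemma Feasible.condEntropy_eq {P : X × Y × W → ℝ} (h : Feasible T R₁ R₂ P) :
    condEntropy (fun (z : X × Y) w => P (z.1, z.2, w)) =
      ∑ w, massEntropy (fun z : X × Y => P (z.1, z.2, w)) :=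
  condEntropy_eq_sum_massEntropy fun _ _ => h.1.1 _

/-- The alphabet of `W` may be enlarged or shrunk by symbols of probability zero. -/
lemma feasible_comp {e : W → W'} (he : Function.Injective e) (P : X × Y × W' → ℝ)
    (hP : ∀ x y w, w ∉ Set.range e → P (x, y, w) = 0) :
    Feasible T R₁ R₂ (fun z : X × Y × W => P (z.1, z.2.1, e z.2.2)) ↔ Feasible T R₁ R₂ P := by
  have h0 : (∀ x y w, 0 ≤ P (x, y, e w)) ↔ ∀ x y w, 0 ≤ P (x, y, w) := by
    refine ⟨fun h x y w => ?_, fun h x y w => h x y _⟩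
    by_cases hw : w ∈ Set.range e
    · obtain ⟨w, rfl⟩ := hw
      exact h x y w
    · rw [hP x y w hw]
  have hT : ∀ x y, ∑ w, P (x, y, e w) = ∑ w, P (x, y, w) := fun x y =>
    sum_comp_injective he _ (hP x y)
  have hX := sum_comp_injective he (fun w => massEntropy (fun x => ∑ y, P (x, y, w)))
    (fun w hw => by simp [hP _ _ w hw])
  have hY := sum_comp_injective he (fun w => massEntropy (fun y => ∑ x, P (x, y, w)))
    (fun w hw => by simp [hP _ _ w hw])
  simp only [feasible_iff, h0, hT, hX, hY]

/-- A feasible triple over any finite alphabet that embeds into `Fin m` contributes to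
`entropyValues T R₁ R₂ m`. -/
lemma Feasible.mem_entropyValues {P : X × Y × W → ℝ} (h : Feasible T R₁ R₂ P) {m : ℕ}
    {e : W → Fin m} (he : Function.Injective e) :
    condEntropy (fun (z : X × Y) w => P (z.1, z.2, w)) ∈ entropyValues T R₁ R₂ m := by
  classical
  let P' : X × Y × Fin m → ℝ := fun z => Function.extend e (fun w => P (z.1, z.2.1, w)) 0 z.2.2
  have hz : ∀ x y w, w ∉ Set.range e → P' (x, y, w) = 0 := fun x y w hw => by
    simp only [P']
    rw [Function.extend_apply' _ _ _ (by simpa using hw)]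
    rfl
  have hPP : ∀ x y w, P' (x, y, e w) = P (x, y, w) := fun x y w => he.extend_apply _ _ _
  refine ⟨P', (feasible_comp he P' hz).mp ?_, ?_⟩
  · simpa only [hPP] using h
  · rw [← condEntropy_comp he _ fun z w hw => hz z.1 z.2 w hw]
    simp only [hPP]

lemma Feasible.exists_mem_entropyValues {P : X × Y × W → ℝ} (h : Feasible T R₁ R₂ P) :
    ∃ m, condEntropy (fun (z : X × Y) w => P (z.1, z.2, w)) ∈ entropyValues T R₁ R₂ m :=
  ⟨_, h.mem_entropyValues (Fintype.equivFin W).injective⟩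

lemma entropyValues_mono {m m' : ℕ} (h : m ≤ m') :
    entropyValues T R₁ R₂ m ⊆ entropyValues T R₁ R₂ m' := by
  rintro _ ⟨P, hP, rfl⟩
  exact hP.mem_entropyValues (Fin.castLE_injective h)

/-- Reduction of the alphabet of `W`. The weights of the columns solve `|X| |Y| + 2` linear
equations (the law of `(X, Y)` and the two conditional entropies); with more columns than that,
the weights can be moved within the solution set, in the direction in which the objective
`H(X Y | W)` does not decrease, until a column disappears. -/
lemma Feasible.exists_card_pred {m : ℕ} (hm : Fintype.card X * Fintype.card Y + 2 < m + 1)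
    {P : X × Y × Fin (m + 1) → ℝ} (h : Feasible T R₁ R₂ P) :
    ∃ P' : X × Y × Fin m → ℝ, Feasible T R₁ R₂ P' ∧
      condEntropy (fun (z : X × Y) w => P (z.1, z.2, w)) ≤
        condEntropy (fun (z : X × Y) w => P' (z.1, z.2, w)) := by
  suffices hs : ∃ (P' : X × Y × Fin (m + 1) → ℝ) (w₀ : Fin (m + 1)), Feasible T R₁ R₂ P' ∧
      (∀ x y, P' (x, y, w₀) = 0) ∧ condEntropy (fun (z : X × Y) w => P (z.1, z.2, w)) ≤
        condEntropy (fun (z : X × Y) w => P' (z.1, z.2, w)) by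
    obtain ⟨P', w₀, hf, hw, hle⟩ := hs
    have hz : ∀ x y w, w ∉ Set.range w₀.succAbove → P' (x, y, w) = 0 := by
      intro x y w hw'
      simp only [Fin.range_succAbove, Set.mem_compl_iff, Set.mem_singleton_iff, not_not] at hw'
      rw [hw', hw]
    refine ⟨_, (feasible_comp Fin.succAbove_right_injective P' hz).mpr hf, hle.trans_eq ?_⟩
    exact (condEntropy_comp Fin.succAbove_right_injective (fun (z : X × Y) w => P' (z.1, z.2, w))
      fun z w => hz z.1 z.2 w).symm
  by_cases hz : ∃ w₀, ∀ x y, P (x, y, w₀) = 0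
  · obtain ⟨w₀, hw₀⟩ := hz
    exact ⟨P, w₀, h, hw₀, le_rfl⟩
  push Not at hz
  obtain ⟨h0, h1, hT, hX, hY⟩ := feasible_iff.mp h
  let hx : Fin (m + 1) → ℝ := fun w => massEntropy (fun x => ∑ y, P (x, y, w))
  let hy : Fin (m + 1) → ℝ := fun w => massEntropy (fun y => ∑ x, P (x, y, w))
  let hxy : Fin (m + 1) → ℝ := fun w => massEntropy (fun z : X × Y => P (z.1, z.2, w))
  let M : Matrix ((X × Y) ⊕ Bool) (Fin (m + 1)) ℝ :=
    Matrix.of (Sum.elim (fun z w => P (z.1, z.2, w)) fun b w => if b then hx w else hy w)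
  have hker : LinearMap.ker M.mulVecLin ≠ ⊥ := by
    apply LinearMap.ker_ne_bot_of_finrank_lt
    simpa using hm
  obtain ⟨l, hl, hl0⟩ := Submodule.exists_mem_ne_zero_of_ne_bot hker
  have hl' : M.mulVec l = 0 := hl
  obtain ⟨c, hc0, hcT, hcX, hcY, hcXY⟩ : ∃ c : Fin (m + 1) → ℝ, c ≠ 0 ∧
      (∀ x y, ∑ w, c w * P (x, y, w) = 0) ∧ ∑ w, c w * hx w = 0 ∧ ∑ w, c w * hy w = 0 ∧
      0 ≤ ∑ w, c w * hxy w := by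
    have e1 : ∀ x y, ∑ w, l w * P (x, y, w) = 0 := fun x y => by
      have := congrFun hl' (Sum.inl (x, y))
      simpa [M, Matrix.mulVec, dotProduct, mul_comm] using this
    have e2 : ∑ w, l w * hx w = 0 := by
      have := congrFun hl' (Sum.inr true)
      simpa [M, Matrix.mulVec, dotProduct, mul_comm] using this
    have e3 : ∑ w, l w * hy w = 0 := by
      have := congrFun hl' (Sum.inr false)
      simpa [M, Matrix.mulVec, dotProduct, mul_comm] using this
    rcases le_total 0 (∑ w, l w * hxy w) with hp | hp
    · exact ⟨l, hl0, e1, e2, e3, hp⟩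
    · refine ⟨-l, neg_ne_zero.mpr hl0, ?_, ?_, ?_, ?_⟩ <;>
        simp only [Pi.neg_apply, neg_mul, Finset.sum_neg_distrib, e1, e2, e3, neg_zero,
          implies_true, Left.nonneg_neg_iff, hp]
  obtain ⟨w₀, -, hw₀⟩ := Finset.exists_min_image Finset.univ c Finset.univ_nonempty
  have hneg : c w₀ < 0 := by
    by_contra hcon
    push Not at hcon
    have hcn : ∀ w, 0 ≤ c w := fun w => hcon.trans (hw₀ w (Finset.mem_univ w))
    apply hc0
    funext w
    obtain ⟨x, y, hxy0⟩ := hz w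
    have := (Finset.sum_eq_zero_iff_of_nonneg
      fun w _ => mul_nonneg (hcn w) (h0 x y w)).mp (hcT x y) w (Finset.mem_univ w)
    exact (mul_eq_zero.mp this).resolve_right hxy0
  have hk : ∀ w, 0 ≤ 1 + (-c w₀)⁻¹ * c w := by
    intro w
    have h2 : (-c w₀)⁻¹ * c w₀ = -1 := by
      rw [inv_neg, neg_mul, inv_mul_cancel₀ hneg.ne]
    have h3 := mul_le_mul_of_nonneg_left (hw₀ w (Finset.mem_univ w))
      (inv_nonneg.mpr (neg_nonneg.mpr hneg.le))
    linarith
  set t := (-c w₀)⁻¹ with ht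
  have ht0 : 0 ≤ t := inv_nonneg.mpr (neg_nonneg.mpr hneg.le)
  have hexp : ∀ g : Fin (m + 1) → ℝ, ∑ w, (1 + t * c w) * g w = ∑ w, g w + t * ∑ w, c w * g w := by
    intro g
    rw [Finset.mul_sum, ← Finset.sum_add_distrib]
    exact Finset.sum_congr rfl fun w _ => by ring
  have hf : Feasible T R₁ R₂ (fun z : X × Y × Fin (m + 1) => (1 + t * c z.2.2) * P z) := by
    refine feasible_iff.mpr ⟨fun x y w => mul_nonneg (hk w) (h0 x y w), h1, ?_, ?_, ?_⟩
    · intro x y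
      simp only
      rw [hexp, hcT, mul_zero, add_zero, hT]
    · simp only [← Finset.mul_sum, massEntropy_const_mul]
      rw [hexp, hcX, mul_zero, add_zero]
      exact hX
    · simp only [← Finset.mul_sum, massEntropy_const_mul]
      rw [hexp, hcY, mul_zero, add_zero]
      exact hY
  refine ⟨_, w₀, hf, ?_, ?_⟩
  · intro x y
    have h2 : t * c w₀ = -1 := by
      rw [ht, inv_neg, neg_mul, inv_mul_cancel₀ hneg.ne]
    simp [h2]
  · rw [h.condEntropy_eq, hf.condEntropy_eq]
    simp only [massEntropy_const_mul]
    rw [hexp]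
    have := mul_nonneg ht0 hcXY
    simp only [hxy] at this ⊢
    linarith

lemma exists_ge_of_mem_entropyValues {m : ℕ} {h : ℝ} (hh : h ∈ entropyValues T R₁ R₂ m) :
    ∃ h' ∈ entropyValues T R₁ R₂ (Fintype.card X * Fintype.card Y + 2), h ≤ h' := by
  induction m generalizing h with
  | zero => exact ⟨h, entropyValues_mono (Nat.zero_le _) hh, le_rfl⟩
  | succ m ih =>
    by_cases hm : Fintype.card X * Fintype.card Y + 2 < m + 1
    · obtain ⟨P, hP, rfl⟩ := hh
      obtain ⟨P', hP', hle⟩ := hP.exists_card_pred hm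
      obtain ⟨h', hh', hle'⟩ := ih ⟨P', hP', rfl⟩
      exact ⟨h', hh', hle.trans hle'⟩
    · exact ⟨h, entropyValues_mono (not_lt.mp hm) hh, le_rfl⟩

/-- Taking `W = (X, Y)` shows that the constraints can be met. -/
lemma entropyValues_nonempty (hT : T ∈ stdSimplex ℝ (X × Y)) (h₁ : 0 ≤ R₁) (h₂ : 0 ≤ R₂) :
    ∃ m ≤ Fintype.card X * Fintype.card Y, (entropyValues T R₁ R₂ m).Nonempty := by
  classical
  refine ⟨Fintype.card (X × Y), (Fintype.card_prod X Y).le, ?_⟩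
  let P : X × Y × (X × Y) → ℝ := fun z => if (z.1, z.2.1) = z.2.2 then T z.2.2 else 0
  have hP0 : ∀ x y w, 0 ≤ P (x, y, w) := fun x y w => by
    simp only [P]
    split_ifs
    exacts [hT.1 _, le_rfl]
  have hP : Feasible T R₁ R₂ P := by
    refine feasible_iff.mpr ⟨hP0, hT.2, fun x y => by simp [P], ?_, ?_⟩
    · refine (Finset.sum_nonpos fun w _ => ?_).trans h₁
      refine (massEntropy_le_mul_log_card (fun x => Finset.sum_nonneg fun y _ => hP0 x y w)
        {w.1} fun x hx => Finset.sum_eq_zero fun y _ => if_neg ?_).trans ?_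
      · exact fun h => hx (Finset.mem_singleton.mpr (congrArg Prod.fst h))
      · simp
    · refine (Finset.sum_nonpos fun w _ => ?_).trans h₂
      refine (massEntropy_le_mul_log_card (fun y => Finset.sum_nonneg fun x _ => hP0 x y w)
        {w.2} fun y hy => Finset.sum_eq_zero fun x _ => if_neg ?_).trans ?_
      · exact fun h => hy (Finset.mem_singleton.mpr (congrArg Prod.snd h))
      · simp
  exact ⟨_, hP.mem_entropyValues (Fintype.equivFin (X × Y)).injective⟩

lemma exists_isGreatest_entropyValues {m : ℕ} (hne : (entropyValues T R₁ R₂ m).Nonempty) :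
    ∃ h, IsGreatest (entropyValues T R₁ R₂ m) h := by
  have hset : {P : X × Y × Fin m → ℝ | Feasible T R₁ R₂ P} = stdSimplex ℝ (X × Y × Fin m) ∩
      {P | (∀ x y, ∑ w, P (x, y, w) = T (x, y)) ∧
        ∑ w, massEntropy (fun x => ∑ y, P (x, y, w)) ≤ R₁ ∧
        ∑ w, massEntropy (fun y => ∑ x, P (x, y, w)) ≤ R₂} := by
    ext P
    constructor
    · intro h
      exact ⟨h.1, (feasible_iff.mp h).2.2⟩
    · rintro ⟨hs, h⟩
      refine feasible_iff.mpr ⟨fun _ _ _ => hs.1 _, ?_, h⟩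
      rw [← hs.2]
      simp only [Fintype.sum_prod_type, h.1]
  have hcl : IsClosed {P : X × Y × Fin m → ℝ | (∀ x y, ∑ w, P (x, y, w) = T (x, y)) ∧
        ∑ w, massEntropy (fun x => ∑ y, P (x, y, w)) ≤ R₁ ∧
        ∑ w, massEntropy (fun y => ∑ x, P (x, y, w)) ≤ R₂} := by
    simp only [Set.ofPred_and, Set.ofPred_forall]
    refine IsClosed.inter ?_ (IsClosed.inter ?_ ?_)
    · exact isClosed_iInter fun x => isClosed_iInter fun y =>
        isClosed_eq (by fun_prop) continuous_const
    · exact isClosed_le (continuous_finsetSum _ fun w _ =>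
        continuous_massEntropy.comp (by fun_prop)) continuous_const
    · exact isClosed_le (continuous_finsetSum _ fun w _ =>
        continuous_massEntropy.comp (by fun_prop)) continuous_const
  have hK : IsCompact {P : X × Y × Fin m → ℝ | Feasible T R₁ R₂ P} := by
    rw [hset]
    exact (isCompact_stdSimplex ℝ _).inter_right hcl
  obtain ⟨_, P₀, hP₀, -⟩ := hne
  have hcont : Continuous fun P : X × Y × Fin m → ℝ =>
      ∑ w, massEntropy (fun z : X × Y => P (z.1, z.2, w)) :=
    continuous_finsetSum _ fun w _ => continuous_massEntropy.comp (by fun_prop)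
  obtain ⟨P, hP, hmax⟩ := hK.exists_isMaxOn ⟨P₀, hP₀⟩ hcont.continuousOn
  refine ⟨_, ⟨P, hP, rfl⟩, ?_⟩
  rintro _ ⟨P', hP', rfl⟩
  rw [Feasible.condEntropy_eq hP, hP'.condEntropy_eq]
  exact hmax hP'

theorem isGreatest_FStar (hT : T ∈ stdSimplex ℝ (X × Y)) (h₁ : 0 ≤ R₁) (h₂ : 0 ≤ R₂) :
    IsGreatest (⋃ m : ℕ, entropyValues T R₁ R₂ m) (FStar T R₁ R₂) ∧
      IsGreatest (entropyValues T R₁ R₂ (Fintype.card X * Fintype.card Y + 2))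
        (FStar T R₁ R₂) := by
  obtain ⟨m, hm, hne⟩ := entropyValues_nonempty hT h₁ h₂
  obtain ⟨h, hh⟩ := exists_isGreatest_entropyValues
    (hne.mono (entropyValues_mono (hm.trans (Nat.le_add_right _ 2))))
  have hU : IsGreatest (⋃ m : ℕ, entropyValues T R₁ R₂ m) h := by
    refine ⟨Set.mem_iUnion.mpr ⟨_, hh.1⟩, fun v hv => ?_⟩
    obtain ⟨m, hv⟩ := Set.mem_iUnion.mp hv
    obtain ⟨h', hh', hle⟩ := exists_ge_of_mem_entropyValues hv
    exact hle.trans (hh.2 hh')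
  rw [FStar, hU.csSup_eq]
  exact ⟨hU, hh⟩

end

/-! ### Single-letterisation of the entropy of a set of sequences -/

section

universe u v

variable {X : Type u} {Y : Type v} [Fintype X] [Fintype Y]

lemma sum_fin_cons {A : Type*} [Fintype A] {n : ℕ} (g : (Fin (n + 1) → A) → ℝ) :
    ∑ s, g s = ∑ a, ∑ s : Fin n → A, g (Fin.cons a s) := by
  rw [← (Fin.consEquiv fun _ => A).sum_comp g, Fintype.sum_prod_type]
  rfl

lemma massEntropy_fin_cons {A : Type*} [Fintype A] {n : ℕ} (g : (Fin (n + 1) → A) → ℝ) :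
    massEntropy g = massEntropy (fun a => ∑ s : Fin n → A, g (Fin.cons a s)) +
      ∑ a, massEntropy (fun s : Fin n → A => g (Fin.cons a s)) := by
  rw [← massEntropy_comp_equiv (Fin.consEquiv fun _ => A) g, massEntropy_prod]
  rfl

open Classical in
/-- Single-letterisation. A law `μ` of a pair of sequences of length `n` gives a triple
`(X, Y, W)`, with `W` a position together with the two prefixes before it: the law of `(X, Y)`
is then the average letter law, `H(X Y | W)` is the entropy of `μ`, and `H(X | W)`, `H(Y | W)` are
at most the entropies of the marginals of `μ`, all up to normalisation. -/
lemma exists_single_letter (n : ℕ) (μ : (Fin n → X) → (Fin n → Y) → ℝ)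
    (hμ : ∀ xs ys, 0 ≤ μ xs ys) :
    ∃ (W : Type (max u v)) (_ : Fintype W) (Q : X → Y → W → ℝ),
      (∀ x y w, 0 ≤ Q x y w) ∧
      (∀ x y, ∑ w, Q x y w =
        ∑ i, ∑ xs, ∑ ys, if xs i = x ∧ ys i = y then μ xs ys else 0) ∧
      ∑ w, massEntropy (fun z : X × Y => Q z.1 z.2 w) =
        massEntropy (fun s : (Fin n → X) × (Fin n → Y) => μ s.1 s.2) ∧
      ∑ w, massEntropy (fun x => ∑ y, Q x y w) ≤ massEntropy (fun xs => ∑ ys, μ xs ys) ∧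
      ∑ w, massEntropy (fun y => ∑ x, Q x y w) ≤ massEntropy (fun ys => ∑ xs, μ xs ys) := by
  induction n with
  | zero =>
    refine ⟨PEmpty, inferInstance, fun _ _ _ => 0, by simp, by simp, ?_, ?_, ?_⟩ <;>
      simp [massEntropy_eq_zero_of_subsingleton]
  | succ n ih =>
    choose W hW Q hQ0 hQT hQXY hQX hQY using fun z : X × Y =>
      ih (fun xs ys => μ (Fin.cons z.1 xs) (Fin.cons z.2 ys)) fun _ _ => hμ _ _
    -- `W` is either trivial, for the first position, or the first pair of letters together with a
    -- symbol for the remaining positions; `first` is the law of the first pair of letters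
    let first : X → Y → ℝ := fun x y =>
      ∑ xs : Fin n → X, ∑ ys : Fin n → Y, μ (Fin.cons x xs) (Fin.cons y ys)
    have hsum : ∀ g : Option (Σ z : X × Y, W z) → ℝ,
        ∑ w, g w = g none + ∑ x, ∑ y, ∑ w, g (some ⟨(x, y), w⟩) := fun g => by
      rw [Fintype.sum_option, Fintype.sum_sigma, Fintype.sum_prod_type]
    refine ⟨Option (Σ z : X × Y, W z), inferInstance,
      fun x y w => w.elim (first x y) fun p => Q p.1 x y p.2, ?_, ?_, ?_, ?_, ?_⟩
    · rintro x y (_ | ⟨z, w⟩)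
      · exact Finset.sum_nonneg fun _ _ => Finset.sum_nonneg fun _ _ => hμ _ _
      · exact hQ0 z x y w
    · intro x y
      rw [hsum, Fin.sum_univ_succ]
      simp only [Option.elim_none, Option.elim_some, hQT, sum_fin_cons, Fin.cons_zero,
        Fin.cons_succ]
      congr 1
      · rw [Finset.sum_eq_single x]
        · simp only [first, true_and]
          refine Finset.sum_congr rfl fun xs _ => ?_
          rw [Finset.sum_eq_single y] <;> simp +contextual
        · simp +contextual
        · simp
      · rw [Finset.sum_congr rfl fun a _ => Finset.sum_comm, Finset.sum_comm]
        refine Finset.sum_congr rfl fun i _ => Finset.sum_congr rfl fun a _ => ?_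
        rw [Finset.sum_comm]
    · rw [hsum]
      simp only [Option.elim_none, Option.elim_some, hQXY]
      let e : ((X × Y) × ((Fin n → X) × (Fin n → Y))) ≃
          ((Fin (n + 1) → X) × (Fin (n + 1) → Y)) :=
        (Equiv.prodProdProdComm _ _ _ _).trans
          ((Fin.consEquiv fun _ => X).prodCongr (Fin.consEquiv fun _ => Y))
      rw [← massEntropy_comp_equiv e,
        massEntropy_prod (fun b : (X × Y) × ((Fin n → X) × (Fin n → Y)) => μ (e b).1 (e b).2)]
      congr 1
      · simp only [first, Fintype.sum_prod_type]
        rfl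
      · rw [Fintype.sum_prod_type]
        rfl
    · rw [hsum, massEntropy_fin_cons]
      simp only [Option.elim_none, Option.elim_some]
      refine add_le_add (le_of_eq ?_) (Finset.sum_le_sum fun x _ => ?_)
      · congr 1
        funext x
        simp only [first, sum_fin_cons]
        rw [Finset.sum_comm]
      · refine (Finset.sum_le_sum fun y _ => hQX (x, y)).trans
          ((sum_massEntropy_le fun y xs => Finset.sum_nonneg fun _ _ => hμ _ _).trans_eq ?_)
        simp only [sum_fin_cons]
    · rw [hsum, massEntropy_fin_cons, Finset.sum_comm]
      simp only [Option.elim_none, Option.elim_some]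
      refine add_le_add (le_of_eq ?_) (Finset.sum_le_sum fun y _ => ?_)
      · congr 1
        funext y
        simp only [first, sum_fin_cons]
        exact (Finset.sum_comm.trans (Finset.sum_congr rfl fun _ _ => Finset.sum_comm)).symm
      · refine (Finset.sum_le_sum fun x _ => hQY (x, y)).trans
          ((sum_massEntropy_le fun x ys => Finset.sum_nonneg fun _ _ => hμ _ _).trans_eq ?_)
        simp only [sum_fin_cons]

end

/-! ### Types and marginals -/

section

variable {X Y A : Type*}

open Classical in
/-- The number of occurrences of the letter `a` in the sequence `z`. -/
noncomputable def count {n : ℕ} (z : Fin n → A) (a : A) : ℕ :=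
  (Finset.univ.filter fun i => z i = a).card

lemma mem_typeClass_iff {n : ℕ} (hn : 1 ≤ n) {T : A → ℝ} {z : Fin n → A} :
    z ∈ typeClass n T ↔ ∀ a, (count z a : ℝ) = n * T a := by
  have hn' : (n : ℝ) ≠ 0 := by positivity
  change empirical z = T ↔ _
  rw [funext_iff]
  refine forall_congr' fun a => ?_
  simp only [empirical, count]
  rw [div_eq_iff hn', mul_comm]

lemma sum_count [Fintype A] {n : ℕ} (z : Fin n → A) : ∑ a, count z a = n := by
  classical
  have := Finset.card_eq_sum_card_fiberwise (s := Finset.univ) (t := Finset.univ) (f := z)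
    (fun _ _ => Finset.mem_coe.mpr (Finset.mem_univ _))
  rw [Finset.card_univ, Fintype.card_fin] at this
  unfold count
  convert this.symm

lemma count_le {n : ℕ} (z : Fin n → A) (a : A) : count z a ≤ n :=
  (Finset.card_le_univ _).trans_eq (Fintype.card_fin n)

lemma count_map_fst [Fintype Y] {n : ℕ} (z : Fin n → X × Y) (x : X) :
    count (fun i => (z i).1) x = ∑ y, count z (x, y) := by
  classical
  unfold count
  rw [Finset.card_eq_sum_card_fiberwise (t := Finset.univ) (f := fun i => (z i).2)
    (fun _ _ => Finset.mem_coe.mpr (Finset.mem_univ _))]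
  refine Finset.sum_congr rfl fun y _ => congrArg _ ?_
  ext i
  simp [Prod.ext_iff]

lemma count_map_snd [Fintype X] {n : ℕ} (z : Fin n → X × Y) (y : Y) :
    count (fun i => (z i).2) y = ∑ x, count z (x, y) := by
  classical
  unfold count
  rw [Finset.card_eq_sum_card_fiberwise (t := Finset.univ) (f := fun i => (z i).1)
    (fun _ _ => Finset.mem_coe.mpr (Finset.mem_univ _))]
  refine Finset.sum_congr rfl fun y _ => congrArg _ ?_
  ext i
  simp [Prod.ext_iff, and_comm]

lemma IsNType.mem_stdSimplex [Fintype A] {n : ℕ} (hn : 1 ≤ n) {T : A → ℝ} (hT : IsNType n T) :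
    T ∈ stdSimplex ℝ A := by
  obtain ⟨z, hz⟩ := hT
  have h := (mem_typeClass_iff hn).mp hz
  have hn' : (0 : ℝ) < n := by positivity
  constructor
  · intro a
    have : 0 ≤ n * T a := by rw [← h]; positivity
    exact nonneg_of_mul_nonneg_right this hn'
  · have h2 : (n : ℝ) * ∑ a, T a = n := by
      rw [Finset.mul_sum, ← Finset.sum_congr rfl fun a _ => h a]
      exact_mod_cast sum_count z
    exact mul_left_cancel₀ hn'.ne' (by rw [h2, mul_one])

lemma fst_mem_typeClass [Fintype Y] {n : ℕ} (hn : 1 ≤ n) {T : X × Y → ℝ} {z : Fin n → X × Y}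
    (hz : z ∈ typeClass n T) : (fun i => (z i).1) ∈ typeClass n (margX T) := by
  rw [mem_typeClass_iff hn] at hz ⊢
  intro x
  rw [count_map_fst, margX, Finset.mul_sum, Nat.cast_sum]
  exact Finset.sum_congr rfl fun y _ => hz _

lemma snd_mem_typeClass [Fintype X] {n : ℕ} (hn : 1 ≤ n) {T : X × Y → ℝ} {z : Fin n → X × Y}
    (hz : z ∈ typeClass n T) : (fun i => (z i).2) ∈ typeClass n (margY T) := by
  rw [mem_typeClass_iff hn] at hz ⊢
  intro x
  rw [count_map_snd, margY, Finset.mul_sum, Nat.cast_sum]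
  exact Finset.sum_congr rfl fun y _ => hz _

variable [Fintype X] [Fintype Y]

/-! ### The upper bound on the number of edges -/

/-- A set of pairs of sequences of joint type `T` whose projections have at most `exp (n R₁)` and
`exp (n R₂)` elements has at most `exp (n F*)` elements. -/
lemma log_card_le_mul_FStar {n : ℕ} (hn : 1 ≤ n) {T : X × Y → ℝ} {R₁ R₂ : ℝ}
    {S : Finset ((Fin n → X) × (Fin n → Y))} (hS : S.Nonempty)
    (hST : ∀ s ∈ S, (fun i => (s.1 i, s.2 i)) ∈ typeClass n T)
    {A : Finset (Fin n → X)} {B : Finset (Fin n → Y)}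
    (hA : ∀ s ∈ S, s.1 ∈ A) (hB : ∀ s ∈ S, s.2 ∈ B)
    (hR₁ : log A.card ≤ n * R₁) (hR₂ : log B.card ≤ n * R₂) :
    log S.card ≤ n * FStar T R₁ R₂ := by
  classical
  have hn' : (0 : ℝ) < n := by positivity
  have hS' : (0 : ℝ) < S.card := by exact_mod_cast hS.card_pos
  obtain ⟨s₀, hs₀⟩ := hS
  have hT : T ∈ stdSimplex ℝ (X × Y) := IsNType.mem_stdSimplex hn ⟨_, hST s₀ hs₀⟩
  have h₁ : 0 ≤ R₁ := nonneg_of_mul_nonneg_right ((log_natCast_nonneg _).trans hR₁) hn'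
  have h₂ : 0 ≤ R₂ := nonneg_of_mul_nonneg_right ((log_natCast_nonneg _).trans hR₂) hn'
  let μ : (Fin n → X) → (Fin n → Y) → ℝ := fun xs ys => if (xs, ys) ∈ S then 1 else 0
  have hμ0 : ∀ xs ys, 0 ≤ μ xs ys := fun xs ys => by
    simp only [μ]
    split_ifs <;> norm_num
  have hμ : ∀ g : (Fin n → X) → (Fin n → Y) → ℝ,
      ∑ xs, ∑ ys, μ xs ys * g xs ys = ∑ s ∈ S, g s.1 s.2 := by
    intro g
    rw [← Fintype.sum_prod_type' fun xs ys => μ xs ys * g xs ys]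
    simp [μ]
  have hμ1 : ∑ xs, ∑ ys, μ xs ys = S.card := by
    simpa using hμ fun _ _ => 1
  obtain ⟨W, _, Q, hQ0, hQT, hQXY, hQX, hQY⟩ := exists_single_letter n μ hμ0
  have hXY : ∑ w, massEntropy (fun z : X × Y => Q z.1 z.2 w) = S.card * log S.card := by
    rw [hQXY, massEntropy, Fintype.sum_prod_type' μ, hμ1]
    have : ∀ s : (Fin n → X) × (Fin n → Y), negMulLog (μ s.1 s.2) = 0 := fun s => by
      simp only [μ]
      split_ifs <;> simp
    rw [Finset.sum_eq_zero fun s _ => this s, negMulLog]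
    ring
  have hX : ∑ w, massEntropy (fun x => ∑ y, Q x y w) ≤ S.card * (n * R₁) := by
    refine hQX.trans ((massEntropy_le_mul_log_card
      (fun xs => Finset.sum_nonneg fun ys _ => hμ0 xs ys) A fun xs hxs =>
        Finset.sum_eq_zero fun ys _ => if_neg fun h => hxs (hA _ h)).trans ?_)
    rw [hμ1]
    exact mul_le_mul_of_nonneg_left hR₁ hS'.le
  have hY : ∑ w, massEntropy (fun y => ∑ x, Q x y w) ≤ S.card * (n * R₂) := by
    refine hQY.trans ((massEntropy_le_mul_log_card
      (fun ys => Finset.sum_nonneg fun xs _ => hμ0 xs ys) B fun ys hys =>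
        Finset.sum_eq_zero fun xs _ => if_neg fun h => hys (hB _ h)).trans ?_)
    rw [Finset.sum_comm, hμ1]
    exact mul_le_mul_of_nonneg_left hR₂ hS'.le
  have hlaw : ∀ x y, ∑ w, Q x y w = S.card * (n * T (x, y)) := by
    intro x y
    rw [hQT]
    have h1 : ∀ i : Fin n, ∑ xs, ∑ ys, (if xs i = x ∧ ys i = y then μ xs ys else 0) =
        ∑ s ∈ S, if s.1 i = x ∧ s.2 i = y then 1 else 0 := by
      intro i
      rw [← hμ fun xs ys => if xs i = x ∧ ys i = y then 1 else 0]
      simp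
    rw [Finset.sum_congr rfl fun i _ => h1 i, Finset.sum_comm, ← nsmul_eq_mul]
    refine Finset.sum_eq_card_nsmul fun s hs => ?_
    rw [← (mem_typeClass_iff hn).mp (hST s hs) (x, y)]
    simp [count]
  have hc : 0 ≤ ((S.card : ℝ) * n)⁻¹ := by positivity
  have hf : Feasible T R₁ R₂ (fun z : X × Y × W => ((S.card : ℝ) * n)⁻¹ * Q z.1 z.2.1 z.2.2) := by
    refine feasible_iff.mpr ⟨fun x y w => mul_nonneg hc (hQ0 x y w), hT.2, fun x y => ?_, ?_, ?_⟩
    · simp only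
      rw [← Finset.mul_sum, hlaw]
      field_simp
    · simp only [← Finset.mul_sum, massEntropy_const_mul]
      refine (mul_le_mul_of_nonneg_left hX hc).trans_eq ?_
      field_simp
    · simp only [← Finset.mul_sum, massEntropy_const_mul]
      refine (mul_le_mul_of_nonneg_left hY hc).trans_eq ?_
      field_simp
  obtain ⟨m, hm⟩ := hf.exists_mem_entropyValues
  have hle := (isGreatest_FStar hT h₁ h₂).1.2 (Set.mem_iUnion.mpr ⟨m, hm⟩)
  rw [hf.condEntropy_eq] at hle
  simp only [massEntropy_const_mul, ← Finset.mul_sum] at hle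
  rw [hXY] at hle
  have e : ((S.card : ℝ) * n)⁻¹ * (S.card * log S.card) = log S.card / n := by field_simp
  rw [e, div_le_iff₀ hn'] at hle
  linarith

/-! ### The density of induced subgraphs -/

open Classical in
/-- The edges of the type graph between `A` and `B`. -/
noncomputable def edges {n : ℕ} (T : X × Y → ℝ)
    (A : Finset (typeClass n (margX T))) (B : Finset (typeClass n (margY T))) :
    Finset (typeClass n (margX T) × typeClass n (margY T)) :=
  (A ×ˢ B).filter fun p => (fun i => (p.1.1 i, p.2.1 i)) ∈ typeClass n T

lemma density_eq {n : ℕ} (T : X × Y → ℝ)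
    (A : Finset (typeClass n (margX T))) (B : Finset (typeClass n (margY T))) :
    density n T A B = (edges T A B).card / (A.card * B.card) := by
  classical
  rw [density, SimpleGraph.edgeDensity_def]
  have h : ((typeGraph n T).interedges (A.map .inl) (B.map .inr)).card = (edges T A B).card := by
    symm
    refine Finset.card_bij (fun p _ => (Sum.inl p.1, Sum.inr p.2)) ?_ ?_ ?_
    · rintro ⟨a, b⟩ h
      simp only [edges, Finset.mem_filter, Finset.mem_product] at h
      rw [SimpleGraph.mem_interedges_iff]
      exact ⟨by simpa using h.1.1, by simpa using h.1.2, h.2⟩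
    · rintro ⟨a, b⟩ _ ⟨a', b'⟩ _ h
      simpa using h
    · rintro ⟨a, b⟩ h
      rw [SimpleGraph.mem_interedges_iff] at h
      obtain ⟨ha, hb, hab⟩ := h
      obtain ⟨a, ha', rfl⟩ := Finset.mem_map.mp ha
      obtain ⟨b, hb', rfl⟩ := Finset.mem_map.mp hb
      refine ⟨(a, b), ?_, rfl⟩
      simp only [edges, Finset.mem_filter, Finset.mem_product]
      exact ⟨⟨ha', hb'⟩, hab⟩
  push_cast
  simp only [Finset.card_map]
  congr 2

lemma density_le_maxDensity {n : ℕ} (T : X × Y → ℝ)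
    (A : Finset (typeClass n (margX T))) (B : Finset (typeClass n (margY T))) :
    density n T A B ≤ maxDensity n T A.card B.card := by
  refine le_csSup ⟨1, ?_⟩ ⟨A, B, rfl, rfl, rfl⟩
  rintro _ ⟨A, B, -, -, rfl⟩
  classical
  unfold density
  exact_mod_cast SimpleGraph.edgeDensity_le_one _ _ _

/-- The converse bound `EStar ≤ exponent`, in terms of the maximal density. The positivity hypothesis
excludes the junk value `log 0 = 0`. -/
lemma log_maxDensity_le {n : ℕ} (hn : 1 ≤ n) {T : X × Y → ℝ} {M₁ M₂ : ℕ}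
    (hM₁ : 1 ≤ M₁) (hM₂ : 1 ≤ M₂) {R₁ R₂ : ℝ} (hR₁ : log M₁ = n * R₁) (hR₂ : log M₂ = n * R₂)
    (hpos : 0 < maxDensity n T M₁ M₂) :
    log (maxDensity n T M₁ M₂) ≤ n * FStar T R₁ R₂ - n * R₁ - n * R₂ := by
  classical
  have hM₁' : (0 : ℝ) < M₁ := by exact_mod_cast hM₁
  have hM₂' : (0 : ℝ) < M₂ := by exact_mod_cast hM₂
  rw [log_le_iff_le_exp hpos]
  refine Real.sSup_le ?_ (exp_pos _).le
  rintro _ ⟨A, B, hA, hB, rfl⟩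
  rw [density_eq, hA, hB]
  rcases (edges T A B).eq_empty_or_nonempty with h | h
  · rw [h]
    simp [(exp_pos _).le]
  have hc : (0 : ℝ) < (edges T A B).card := by exact_mod_cast h.card_pos
  rw [← log_le_iff_le_exp (by positivity), log_div hc.ne' (by positivity),
    log_mul hM₁'.ne' hM₂'.ne', hR₁, hR₂]
  have hinj : Function.Injective fun p : typeClass n (margX T) × typeClass n (margY T) =>
      (p.1.1, p.2.1) := by
    rintro ⟨a, b⟩ ⟨a', b'⟩ h
    simpa [Subtype.ext_iff] using h
  have := log_card_le_mul_FStar hn (T := T) (R₁ := R₁) (R₂ := R₂)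
    (S := (edges T A B).image fun p => (p.1.1, p.2.1)) (h.image _) ?_
    (A := A.image Subtype.val) (B := B.image Subtype.val) ?_ ?_ ?_ ?_
  · rw [Finset.card_image_of_injective _ hinj] at this
    linarith
  · simp only [Finset.mem_image]
    rintro _ ⟨p, hp, rfl⟩
    exact (Finset.mem_filter.mp hp).2
  · simp only [Finset.mem_image]
    rintro _ ⟨p, hp, rfl⟩
    exact ⟨p.1, (Finset.mem_product.mp (Finset.mem_filter.mp hp).1).1, rfl⟩
  · simp only [Finset.mem_image]
    rintro _ ⟨p, hp, rfl⟩
    exact ⟨p.2, (Finset.mem_product.mp (Finset.mem_filter.mp hp).1).2, rfl⟩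
  · rw [Finset.card_image_of_injective _ Subtype.val_injective, hA, hR₁]
  · rw [Finset.card_image_of_injective _ Subtype.val_injective, hB, hR₂]

end

/-! ### The cardinality of conditional type classes -/

section

open scoped Nat in
lemma mul_log_sub_le_log_factorial (N : ℕ) : (N : ℝ) * log N - N ≤ log (N ! : ℕ) := by
  rcases Nat.eq_zero_or_pos N with rfl | h
  · simp
  have h1 := Stirling.le_log_factorial_stirling h.ne'
  have h2 := log_natCast_nonneg N
  have h3 : 0 ≤ log (2 * π) := log_nonneg (by linarith [pi_gt_three])
  linarith

open scoped Nat in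
/-- The factorial bound `N! ≤ e √N (N / e) ^ N`, with `e √N` replaced by the bound `n + 1`, valid for
`N ≤ n` as soon as `6 ≤ n`. -/
lemma log_factorial_le {N n : ℕ} (hN : N ≤ n) (hn : 6 ≤ n) :
    log (N ! : ℕ) ≤ (N : ℝ) * log N - N + log (n + 1) := by
  rcases Nat.eq_zero_or_pos N with rfl | h
  · have : 0 ≤ log ((n : ℝ) + 1) := log_nonneg (by linarith [n.cast_nonneg (α := ℝ)])
    simpa using this
  obtain ⟨k, rfl⟩ : ∃ k, N = k + 1 := ⟨N - 1, by omega⟩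
  have h1 : Stirling.stirlingSeq (k + 1) ≤ Stirling.stirlingSeq 1 :=
    Stirling.stirlingSeq'_antitone (Nat.zero_le k)
  have h2 := log_le_log (Stirling.stirlingSeq'_pos k) h1
  rw [Stirling.log_stirlingSeq_formula, Stirling.log_stirlingSeq_formula] at h2
  set N := k + 1
  have hN0 : (0 : ℝ) < N := by exact_mod_cast h
  rw [log_mul two_ne_zero hN0.ne', log_div hN0.ne' (exp_pos 1).ne'] at h2
  simp only [Nat.factorial_one, Nat.cast_one, log_one, mul_one, one_div, log_exp, one_mul,
    log_inv, zero_sub] at h2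
  have h3 : 2 + log N ≤ 2 * log ((n : ℝ) + 1) := by
    have hn' : (6 : ℝ) ≤ n := by exact_mod_cast hn
    have hNn : (N : ℝ) ≤ n := by exact_mod_cast hN
    have e1 : 2 + log (N : ℝ) = log (exp 1 ^ 2 * N) := by
      rw [log_mul (by positivity) hN0.ne', log_pow, log_exp]
      norm_num
    have e2 : 2 * log ((n : ℝ) + 1) = log (((n : ℝ) + 1) ^ 2) := by
      rw [log_pow]
      norm_num
    rw [e1, e2]
    refine log_le_log (by positivity) ?_
    have he : exp 1 ^ 2 ≤ 7.4 := by
      have := exp_one_lt_d9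
      nlinarith [exp_pos 1]
    nlinarith
  linarith

variable {A W : Type*} [Fintype A] [Fintype W] {n : ℕ}

lemma sum_comp_eq_sum_count (u : Fin n → A) (g : A → ℝ) :
    ∑ i, g (u i) = ∑ a, count u a * g a := by
  classical
  rw [← Finset.sum_fiberwise_of_maps_to (s := Finset.univ) (t := Finset.univ) (g := u)
    fun _ _ => Finset.mem_univ _]
  refine Finset.sum_congr rfl fun a _ => ?_
  rw [Finset.sum_congr rfl fun i hi => by rw [(Finset.mem_filter.mp hi).2], Finset.sum_const,
    nsmul_eq_mul]
  simp only [count]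

open Classical in
/-- The sequences that have the same joint type with `w` as the sequence `z`. -/
noncomputable def condClass (z : Fin n → A) (w : Fin n → W) : Finset (Fin n → A) :=
  Finset.univ.filter fun z' => ∀ p, count (fun i => (z' i, w i)) p = count (fun i => (z i, w i)) p

lemma mem_condClass {z z' : Fin n → A} {w : Fin n → W} : z' ∈ condClass z w ↔
    ∀ p, count (fun i => (z' i, w i)) p = count (fun i => (z i, w i)) p := by
  simp [condClass]

/-- The upper bound holds because the conditional type induces a probability on sequences under
which all members of the class have the same probability `exp (-n H(A | W))`. -/
lemma log_card_condClass_le (z : Fin n → A) (w : Fin n → W) :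
    log (condClass z w).card ≤ condEntropy (fun a v => (count (fun i => (z i, w i)) (a, v) : ℝ)) := by
  classical
  set u : Fin n → A × W := fun i => (z i, w i) with hu
  let V : A × W → ℝ := fun p => count u p / ∑ a, (count u (a, p.2) : ℝ)
  have hV0 : ∀ p, 0 ≤ V p := fun p =>
    div_nonneg (Nat.cast_nonneg _) (Finset.sum_nonneg fun _ _ => Nat.cast_nonneg _)
  have hV1 : ∀ v, ∑ a, V (a, v) ≤ 1 := fun v => by
    simp only [V, ← Finset.sum_div]
    exact div_self_le_one _
  have htot : ∑ z' : Fin n → A, ∏ i, V (z' i, w i) ≤ 1 := by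
    have := Finset.prod_univ_sum (fun _ : Fin n => (Finset.univ : Finset A))
      (fun i a => V (a, w i))
    rw [Fintype.piFinset_univ] at this
    rw [← this]
    exact Finset.prod_le_one (fun i _ => Finset.sum_nonneg fun a _ => hV0 _) fun i _ => hV1 _
  have hprob : ∀ z' ∈ condClass z w, ∏ i, V (z' i, w i) =
      exp (-condEntropy (fun a v => (count u (a, v) : ℝ))) := by
    intro z' hz'
    rw [mem_condClass] at hz'
    have hpos : ∀ i, V (z' i, w i) ≠ 0 := by
      intro i
      have h1 : 0 < count u (z' i, w i) := by
        rw [hu, ← hz']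
        exact Finset.card_pos.mpr ⟨i, by simp⟩
      have h2 : (0 : ℝ) < count u (z' i, w i) := by exact_mod_cast h1
      have h3 : (0 : ℝ) < ∑ a, (count u (a, w i) : ℝ) :=
        h2.trans_le (Finset.single_le_sum (f := fun a => (count u (a, w i) : ℝ))
          (fun _ _ => Nat.cast_nonneg _) (Finset.mem_univ (z' i)))
      exact (div_pos h2 h3).ne'
    rw [← exp_log ((Finset.prod_nonneg fun i _ => hV0 (z' i, w i)).lt_of_ne
      (Finset.prod_ne_zero_iff.mpr fun i _ => hpos i).symm), log_prod fun i _ => hpos i,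
      sum_comp_eq_sum_count (fun i => (z' i, w i)) fun p => log (V p)]
    congr 1
    simp only [hz', condEntropy, neg_neg]
    rw [Fintype.sum_prod_type, Finset.sum_comm]
  have hcard : ((condClass z w).card : ℝ) *
      exp (-condEntropy (fun a v => (count u (a, v) : ℝ))) ≤ 1 := by
    rw [← nsmul_eq_mul, ← Finset.sum_const, ← Finset.sum_congr rfl hprob]
    exact (Finset.sum_le_univ_sum_of_nonneg fun z' =>
      Finset.prod_nonneg fun i _ => hV0 _).trans htot
  have hc : (0 : ℝ) < (condClass z w).card := by
    exact_mod_cast Finset.card_pos.mpr ⟨z, mem_condClass (w := w).mpr fun _ => rfl⟩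
  rw [exp_neg, ← div_eq_mul_inv, div_le_one (exp_pos _)] at hcard
  exact (log_le_iff_le_exp hc).mpr hcard

open scoped Nat in
open Classical in
lemma card_stabilizer_eq (u : Fin n → A) :
    (Finset.univ.filter fun g : Equiv.Perm (Fin n) => u ∘ g = u).card = ∏ a, (count u a)! := by
  rw [← Fintype.card_subtype, DomMulAct.stabilizer_card]
  refine Finset.prod_congr rfl fun a _ => ?_
  rw [Fintype.card_subtype]
  rfl

open scoped Nat in
/-- The permutations that fix `w` act on the class of `z`, and the fibres of the orbit map are
cosets of the stabiliser of `(z, w)`. -/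
lemma prod_factorial_count_le (z : Fin n → A) (w : Fin n → W) :
    ∏ v, (count w v)! ≤ (∏ p, (count (fun i => (z i, w i)) p)!) * (condClass z w).card := by
  classical
  rw [← card_stabilizer_eq, ← card_stabilizer_eq]
  refine (Finset.card_le_mul_card_image (f := fun g : Equiv.Perm (Fin n) => z ∘ g) _ _ ?_).trans
    (Nat.mul_le_mul_left _ (Finset.card_le_card ?_))
  · intro z' hz'
    obtain ⟨g₀, hg₀, rfl⟩ := Finset.mem_image.mp hz'
    have hw₀ : w ∘ g₀ = w := (Finset.mem_filter.mp hg₀).2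
    refine Finset.card_le_card_of_injOn (fun g => g * g₀⁻¹) ?_ fun g _ g' _ h =>
      mul_right_cancel h
    intro g hg
    simp only [Finset.coe_filter, Finset.mem_filter, Finset.mem_univ, true_and,
      Set.mem_ofPred_eq] at hg ⊢
    obtain ⟨hw, hz⟩ := hg
    funext i
    have e1 := congrFun hz (g₀⁻¹ i)
    have e2 := congrFun hw (g₀⁻¹ i)
    have e3 := congrFun hw₀ (g₀⁻¹ i)
    have e4 : g₀ (g₀⁻¹ i) = i := g₀.apply_symm_apply i
    simp only [Function.comp_apply, e4] at e1 e2 e3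
    simp only [Function.comp_apply, Equiv.Perm.coe_mul, e1, e2, e3]
  · intro z' hz'
    obtain ⟨g, hg, rfl⟩ := Finset.mem_image.mp hz'
    have hw : w ∘ g = w := (Finset.mem_filter.mp hg).2
    rw [mem_condClass]
    intro p
    unfold count
    refine Finset.card_bij (fun i _ => g i) ?_ (fun i _ j _ h => g.injective h) ?_
    · intro i hi
      have e := congrFun hw i
      simp only [Function.comp_apply] at e
      simpa [e] using hi
    · intro i hi
      have e := congrFun hw (g⁻¹ i)
      have e' : g (g⁻¹ i) = i := g.apply_symm_apply i
      simp only [Function.comp_apply, e'] at e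
      refine ⟨g⁻¹ i, ?_, e'⟩
      simpa only [Finset.mem_filter, Finset.mem_univ, true_and, Function.comp_apply, e', ← e]
        using hi

/-- Up to the factor `(n + 1) ^ (|A| |W|)`, the conditional type class attains the upper bound of
`log_card_condClass_le`. -/
lemma condEntropy_sub_le_log_card_condClass (hn : 6 ≤ n) (z : Fin n → A) (w : Fin n → W) :
    condEntropy (fun a v => (count (fun i => (z i, w i)) (a, v) : ℝ)) -
      Fintype.card A * Fintype.card W * log (n + 1) ≤ log (condClass z w).card := by
  set u : Fin n → A × W := fun i => (z i, w i) with hu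
  have hc : 0 < (condClass z w).card :=
    Finset.card_pos.mpr ⟨z, mem_condClass.mpr fun _ => rfl⟩
  have h1 : log ((∏ v, (count w v).factorial : ℕ) : ℝ) ≤
      log (((∏ p, (count u p).factorial) * (condClass z w).card : ℕ) : ℝ) := by
    refine log_le_log ?_ (by exact_mod_cast prod_factorial_count_le z w)
    exact_mod_cast Finset.prod_pos fun v _ => Nat.factorial_pos _
  rw [Nat.cast_mul, log_mul (by exact_mod_cast (Finset.prod_pos fun v _ => Nat.factorial_pos _).ne')
    (by exact_mod_cast hc.ne'), Nat.cast_prod, Nat.cast_prod,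
    log_prod fun v _ => by exact_mod_cast (Nat.factorial_pos _).ne',
    log_prod fun v _ => by exact_mod_cast (Nat.factorial_pos _).ne'] at h1
  have h2 := Finset.sum_le_sum fun v (_ : v ∈ Finset.univ) =>
    mul_log_sub_le_log_factorial (count w v)
  have h3 := Finset.sum_le_sum fun p (_ : p ∈ Finset.univ) =>
    log_factorial_le (count_le u p) hn
  have h4 : condEntropy (fun a v => (count u (a, v) : ℝ)) =
      ∑ v, ((count w v : ℝ) * log (count w v) - count w v) -
        ∑ p, ((count u p : ℝ) * log (count u p) - count u p) := by
    have e : ∀ v, (count w v : ℝ) = ∑ a, (count u (a, v) : ℝ) := fun v => by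
      rw [← Nat.cast_sum, ← count_map_snd]
    rw [condEntropy_eq_sum_massEntropy fun _ _ => Nat.cast_nonneg _]
    simp only [massEntropy, negMulLog, Finset.sum_sub_distrib, Fintype.sum_prod_type_right, e,
      neg_mul, Finset.sum_neg_distrib]
    ring
  rw [Finset.sum_add_distrib, Finset.sum_const, Finset.card_univ, Fintype.card_prod,
    nsmul_eq_mul, Nat.cast_mul] at h3
  linarith

end

/-! ### Rounding and realising a distribution -/

section

variable {X Y W Z Z' : Type*} {n : ℕ}

/-- Nonnegative reals with an integral sum can be rounded to naturals with the same sum: take the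
differences of the rounded partial sums. -/
lemma exists_nat_round [Fintype W] (p : W → ℝ) (hp : ∀ w, 0 ≤ p w) (N : ℕ) (hN : ∑ w, p w = N) :
    ∃ r : W → ℕ, ∑ w, r w = N ∧ ∀ w, |(r w : ℝ) - p w| ≤ 1 := by
  classical
  have key : ∀ t : Finset W, ∃ r : W → ℕ, ∑ w ∈ t, r w = ⌊∑ w ∈ t, p w⌋₊ ∧
      ∀ w ∈ t, |(r w : ℝ) - p w| ≤ 1 := by
    intro t
    induction t using Finset.induction_on with
    | empty => exact ⟨0, by simp, by simp⟩
    | insert a t ha ih =>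
      obtain ⟨r, hr, hr1⟩ := ih
      set s := ∑ w ∈ t, p w
      have hs : 0 ≤ s := Finset.sum_nonneg fun w _ => hp w
      have hle : ⌊s⌋₊ ≤ ⌊p a + s⌋₊ := Nat.floor_mono (by linarith [hp a])
      refine ⟨Function.update r a (⌊p a + s⌋₊ - ⌊s⌋₊), ?_, ?_⟩
      · rw [Finset.sum_insert ha, Finset.sum_insert ha, Function.update_self,
          Finset.sum_update_of_notMem ha, hr, Nat.sub_add_cancel hle]
      · intro w hw
        rcases Finset.mem_insert.mp hw with rfl | hw'
        · rw [Function.update_self, Nat.cast_sub hle, abs_le]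
          have h1 := Nat.floor_le hs
          have h2 := Nat.lt_floor_add_one s
          have h3 := Nat.floor_le (add_nonneg (hp w) hs)
          have h4 := Nat.lt_floor_add_one (p w + s)
          constructor <;> linarith
        · rw [Function.update_of_ne (by rintro rfl; exact ha hw')]
          exact hr1 w hw'
  obtain ⟨r, hr, hr1⟩ := key Finset.univ
  exact ⟨r, by rw [hr, hN, Nat.floor_natCast], fun w => hr1 w (Finset.mem_univ w)⟩

lemma exists_count_eq [Fintype Z] (N : Z → ℕ) (hN : ∑ z, N z = n) :
    ∃ u : Fin n → Z, ∀ z, count u z = N z := by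
  classical
  let e : Fin n ≃ Σ z, Fin (N z) := Fintype.equivOfCardEq (by simp [hN])
  refine ⟨fun i => (e i).1, fun z => ?_⟩
  unfold count
  rw [← Fintype.card_subtype, Fintype.card_congr
    (e.subtypeEquiv (q := fun s => s.1 = z) fun _ => Iff.rfl),
    Fintype.card_congr (Equiv.sigmaSubtype z), Fintype.card_fin]

lemma count_comp_injective {f : Z → Z'} (hf : Function.Injective f) (u : Fin n → Z) (z : Z) :
    count (fun i => f (u i)) (f z) = count u z := by
  unfold count
  congr 1
  ext i
  simp [hf.eq_iff]

lemma count_comp_congr [Fintype Z] {u u' : Fin n → Z} (h : ∀ z, count u z = count u' z)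
    (f : Z → Z') (b : Z') : count (fun i => f (u i)) b = count (fun i => f (u' i)) b := by
  classical
  have e : ∀ u : Fin n → Z, count (fun i => f (u i)) b =
      ∑ z, if f z = b then count u z else 0 := by
    intro u
    unfold count
    rw [Finset.card_eq_sum_card_fiberwise (t := Finset.univ) (f := u)
      (fun _ _ => Finset.mem_coe.mpr (Finset.mem_univ _))]
    refine Finset.sum_congr rfl fun z _ => ?_
    rw [Finset.filter_filter]
    split_ifs with hz
    · congr 1
      ext i
      simp only [Finset.mem_filter, Finset.mem_univ, true_and, and_iff_right_iff_imp]
      rintro rfl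
      exact hz
    · rw [Finset.card_eq_zero, Finset.filter_eq_empty_iff]
      rintro i - ⟨h1, rfl⟩
      exact hz h1
  rw [e, e]
  simp only [h]

end

/-! ### Subsets of prescribed size with many edges -/

section

/-- Some `M` elements of `S` carry at least their share of the sum of `f`: remove elements of least
value one at a time. -/
lemma exists_subset_card_eq_mul_sum_le {α : Type*} (f : α → ℝ) {M : ℕ} :
    ∀ S : Finset α, M ≤ S.card →
      ∃ S' ⊆ S, S'.card = M ∧ M * ∑ a ∈ S, f a ≤ S.card * ∑ a ∈ S', f a := by
  classical
  intro S
  induction S using Finset.strongInduction with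
  | H S ih =>
    intro hM
    rcases hM.eq_or_lt with h | h
    · exact ⟨S, subset_rfl, h.symm, by rw [h]⟩
    rcases Nat.eq_zero_or_pos M with rfl | hM0
    · exact ⟨∅, by simp, by simp, by simp⟩
    obtain ⟨a, ha, hmin⟩ := S.exists_min_image f (Finset.card_pos.mp (by omega))
    have hc : (S.erase a).card = S.card - 1 := Finset.card_erase_of_mem ha
    obtain ⟨S', hS', hcard, hle⟩ := ih (S.erase a) (Finset.erase_ssubset ha) (by omega)
    refine ⟨S', hS'.trans (Finset.erase_subset _ _), hcard, ?_⟩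
    have hsum : f a + ∑ b ∈ S.erase a, f b = ∑ b ∈ S, f b := Finset.add_sum_erase S f ha
    have hmin' : S.card * f a ≤ ∑ b ∈ S, f b := by
      rw [← nsmul_eq_mul]
      exact Finset.card_nsmul_le_sum _ _ _ hmin
    rw [hc, Nat.cast_sub (by omega), Nat.cast_one] at hle
    have hS1 : (0 : ℝ) < S.card - 1 := by
      have : (1 : ℝ) < S.card := by exact_mod_cast (by omega : 1 < S.card)
      linarith
    have hMp : (0 : ℝ) < M := by exact_mod_cast hM0
    set s := ∑ b ∈ S, f b
    set s' := ∑ b ∈ S', f b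
    set e := ∑ b ∈ S.erase a, f b
    -- dropping the least value keeps at least the fraction `(|S| - 1) / |S|` of the sum
    have h1 : ((S.card : ℝ) - 1) * s ≤ S.card * e := by
      nlinarith
    have h2 : ((S.card : ℝ) - 1) * (M * s) ≤ ((S.card : ℝ) - 1) * (S.card * s') := by
      have := mul_le_mul_of_nonneg_left h1 hMp.le
      have := mul_le_mul_of_nonneg_left hle (Nat.cast_nonneg (α := ℝ) S.card)
      nlinarith
    exact le_of_mul_le_mul_left h2 hS1

/-- A set that is too large by a factor of at most `exp δ` can be replaced by one of the prescribed
size `M`, at the cost of the same factor in the sum of a nonnegative function. -/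
lemma exists_card_eq_sum_le {α : Type*} [Fintype α] {f : α → ℝ} (hf : ∀ a, 0 ≤ f a) {M : ℕ}
    (hM0 : 1 ≤ M) (hM : M ≤ Fintype.card α) (S : Finset α) {δ : ℝ} (hδ : 0 ≤ δ)
    (hS : (S.card : ℝ) ≤ exp δ * M) :
    ∃ S' : Finset α, S'.card = M ∧ ∑ a ∈ S, f a ≤ exp δ * ∑ a ∈ S', f a := by
  rcases le_total M S.card with h | h
  · obtain ⟨S', -, hc, hle⟩ := exists_subset_card_eq_mul_sum_le f S h
    refine ⟨S', hc, ?_⟩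
    have hMp : (0 : ℝ) < M := by exact_mod_cast hM0
    have h0 : 0 ≤ ∑ a ∈ S', f a := Finset.sum_nonneg fun a _ => hf a
    refine le_of_mul_le_mul_left (hle.trans ?_) hMp
    have := mul_le_mul_of_nonneg_right hS h0
    linarith
  · obtain ⟨S', hSS', hc⟩ := Finset.exists_superset_card_eq h hM
    refine ⟨S', hc, ?_⟩
    have h0 : 0 ≤ ∑ a ∈ S', f a := Finset.sum_nonneg fun a _ => hf a
    have h1 : ∑ a ∈ S, f a ≤ ∑ a ∈ S', f a :=
      Finset.sum_le_sum_of_subset_of_nonneg hSS' fun a _ _ => hf a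
    have h2 := mul_le_mul_of_nonneg_right (one_le_exp hδ) h0
    linarith

variable {X Y : Type*} [Fintype X] [Fintype Y] {n : ℕ}

open Classical in
lemma card_edges_eq_sum (T : X × Y → ℝ) (A : Finset (typeClass n (margX T)))
    (B : Finset (typeClass n (margY T))) :
    ((edges T A B).card : ℝ) = ∑ a ∈ A, ∑ b ∈ B,
      if (fun i => (a.1 i, b.1 i)) ∈ typeClass n T then 1 else 0 := by
  rw [edges, Finset.card_filter, Nat.cast_sum, Finset.sum_product]
  simp

/-- Any pair of sets of at most `exp δ₁ M₁` and `exp δ₂ M₂` vertices gives a lower bound on the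
maximal density for the sizes `M₁` and `M₂`. -/
lemma log_card_edges_le {T : X × Y → ℝ} {M₁ M₂ : ℕ} (hM₁ : 1 ≤ M₁) (hM₂ : 1 ≤ M₂)
    (hM₁' : M₁ ≤ (typeClass n (margX T)).ncard) (hM₂' : M₂ ≤ (typeClass n (margY T)).ncard)
    (A : Finset (typeClass n (margX T))) (B : Finset (typeClass n (margY T))) {δ₁ δ₂ : ℝ}
    (hδ₁ : 0 ≤ δ₁) (hδ₂ : 0 ≤ δ₂)
    (hA : (A.card : ℝ) ≤ exp δ₁ * M₁) (hB : (B.card : ℝ) ≤ exp δ₂ * M₂)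
    (hne : (edges T A B).Nonempty) :
    0 < maxDensity n T M₁ M₂ ∧
      log (edges T A B).card - δ₁ - δ₂ - log M₁ - log M₂ ≤ log (maxDensity n T M₁ M₂) := by
  classical
  have : Fintype (typeClass n (margX T)) := Fintype.ofFinite _
  have : Fintype (typeClass n (margY T)) := Fintype.ofFinite _
  let g : typeClass n (margX T) → typeClass n (margY T) → ℝ := fun a b =>
    if (fun i => (a.1 i, b.1 i)) ∈ typeClass n T then 1 else 0
  have hg : ∀ a b, 0 ≤ g a b := fun a b => by
    simp only [g]
    split_ifs <;> norm_num
  rw [← Nat.card_coe_set_eq, Nat.card_eq_fintype_card] at hM₁' hM₂'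
  obtain ⟨A', hA', hle₁⟩ := exists_card_eq_sum_le (f := fun a => ∑ b ∈ B, g a b)
    (fun a => Finset.sum_nonneg fun b _ => hg a b) hM₁ hM₁' A hδ₁ hA
  obtain ⟨B', hB', hle₂⟩ := exists_card_eq_sum_le (f := fun b => ∑ a ∈ A', g a b)
    (fun b => Finset.sum_nonneg fun a _ => hg a b) hM₂ hM₂' B hδ₂ hB
  have hle : ((edges T A B).card : ℝ) ≤ exp δ₁ * (exp δ₂ * (edges T A' B').card) := by
    rw [card_edges_eq_sum, card_edges_eq_sum]
    refine hle₁.trans (mul_le_mul_of_nonneg_left ?_ (exp_pos _).le)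
    rw [Finset.sum_comm (s := A') (t := B'), Finset.sum_comm]
    exact hle₂
  have hp : (0 : ℝ) < (edges T A B).card := by exact_mod_cast hne.card_pos
  have hp' : (0 : ℝ) < (edges T A' B').card := by
    by_contra h
    have h0 : ((edges T A' B').card : ℝ) = 0 := le_antisymm (not_lt.mp h) (Nat.cast_nonneg _)
    rw [h0] at hle
    linarith
  have hM₁p : (0 : ℝ) < M₁ := by exact_mod_cast hM₁
  have hM₂p : (0 : ℝ) < M₂ := by exact_mod_cast hM₂
  have hd := density_le_maxDensity T A' B'
  rw [density_eq, hA', hB'] at hd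
  have hd0 : (0 : ℝ) < (edges T A' B').card / (M₁ * M₂) := by positivity
  refine ⟨hd0.trans_le hd, ?_⟩
  have h1 := log_le_log hd0 hd
  rw [log_div hp'.ne' (by positivity), log_mul hM₁p.ne' hM₂p.ne'] at h1
  have h2 := log_le_log hp hle
  rw [log_mul (exp_pos _).ne' (by positivity), log_mul (exp_pos _).ne' hp'.ne', log_exp,
    log_exp] at h2
  linarith

end

/-! ### The lower bound on the maximal density -/

section

variable {X Y : Type*} [Fintype X] [Fintype Y] {n : ℕ}

lemma condEntropy_const_mul {A W : Type*} [Fintype A] [Fintype W] {c : ℝ} (hc : 0 ≤ c)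
    {Q : A → W → ℝ} (hQ : ∀ a w, 0 ≤ Q a w) :
    condEntropy (fun a w => c * Q a w) = c * condEntropy Q := by
  rw [condEntropy_eq_sum_massEntropy hQ,
    condEntropy_eq_sum_massEntropy fun a w => mul_nonneg hc (hQ a w), Finset.mul_sum]
  exact Finset.sum_congr rfl fun w _ => massEntropy_const_mul c _

/-- A sequence of triples `(x, y, w)` with `(x, y)` of joint type `T` gives the subgraph on the
conditional type classes of `x` and of `y` given `w`; every member of the conditional type class
of `(x, y)` given `w` is one of its edges. -/
lemma log_maxDensity_ge_of_sequence (hn : 6 ≤ n) {m : ℕ} {T : X × Y → ℝ} {M₁ M₂ : ℕ}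
    (hM₁ : 1 ≤ M₁) (hM₂ : 1 ≤ M₂)
    (hM₁' : M₁ ≤ (typeClass n (margX T)).ncard) (hM₂' : M₂ ≤ (typeClass n (margY T)).ncard)
    (u : Fin n → X × Y × Fin m) (hu : (fun i => ((u i).1, (u i).2.1)) ∈ typeClass n T)
    {δ₁ δ₂ : ℝ} (hδ₁ : 0 ≤ δ₁) (hδ₂ : 0 ≤ δ₂)
    (h₁ : condEntropy (fun x w => ∑ y, (count u (x, y, w) : ℝ)) ≤ log M₁ + δ₁)
    (h₂ : condEntropy (fun y w => ∑ x, (count u (x, y, w) : ℝ)) ≤ log M₂ + δ₂) :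
    0 < maxDensity n T M₁ M₂ ∧
      condEntropy (fun (z : X × Y) w => (count u (z.1, z.2, w) : ℝ)) -
        Fintype.card X * Fintype.card Y * m * log (n + 1) - δ₁ - δ₂ - log M₁ - log M₂ ≤
        log (maxDensity n T M₁ M₂) := by
  classical
  have hn1 : 1 ≤ n := by omega
  have : Fintype (typeClass n (margX T)) := Fintype.ofFinite _
  have : Fintype (typeClass n (margY T)) := Fintype.ofFinite _
  let x : Fin n → X := fun i => (u i).1
  let y : Fin n → Y := fun i => (u i).2.1
  let w : Fin n → Fin m := fun i => (u i).2.2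
  let z : Fin n → X × Y := fun i => (x i, y i)
  have hcz : ∀ (p : X × Y) v, count (fun i => (z i, w i)) (p, v) = count u (p.1, p.2, v) := by
    intro p v
    exact count_comp_injective (f := fun t : X × Y × Fin m => ((t.1, t.2.1), t.2.2))
      (by rintro ⟨a, b, c⟩ ⟨a', b', c'⟩ h; simp_all) u (p.1, p.2, v)
  have hcx : ∀ a v, count (fun i => (x i, w i)) (a, v) = ∑ b, count u (a, b, v) := by
    intro a v
    rw [count_map_fst (fun i => ((x i, w i), y i))]
    refine Finset.sum_congr rfl fun b _ => ?_
    exact count_comp_injective (f := fun t : X × Y × Fin m => ((t.1, t.2.2), t.2.1))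
      (by rintro ⟨a, b, c⟩ ⟨a', b', c'⟩ h; simp_all) u (a, b, v)
  have hcy : ∀ b v, count (fun i => (y i, w i)) (b, v) = ∑ a, count u (a, b, v) := by
    intro b v
    rw [count_map_fst (fun i => ((y i, w i), x i))]
    refine Finset.sum_congr rfl fun a _ => ?_
    exact count_comp_injective (f := fun t : X × Y × Fin m => ((t.2.1, t.2.2), t.1))
      (by rintro ⟨a, b, c⟩ ⟨a', b', c'⟩ h; simp_all) u (a, b, v)
  have hX := log_card_condClass_le x w
  have hY := log_card_condClass_le y w
  have hXY := condEntropy_sub_le_log_card_condClass hn z w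
  simp only [hcx, hcy, hcz, Nat.cast_sum, Fintype.card_prod, Fintype.card_fin,
    Nat.cast_mul] at hX hY hXY
  let A : Finset (typeClass n (margX T)) := Finset.univ.filter fun a => a.1 ∈ condClass x w
  let B : Finset (typeClass n (margY T)) := Finset.univ.filter fun b => b.1 ∈ condClass y w
  have hbound : ∀ {c M : ℕ} {h δ : ℝ} , 1 ≤ M → log c ≤ h → h ≤ log M + δ →
      (c : ℝ) ≤ exp δ * M := by
    intro c M h δ hM h1 h2
    have hMp : (0 : ℝ) < M := by exact_mod_cast hM
    rcases Nat.eq_zero_or_pos c with rfl | hc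
    · rw [Nat.cast_zero]
      positivity
    · have hcp : (0 : ℝ) < c := by exact_mod_cast hc
      refine (le_exp_log _).trans ((exp_le_exp.mpr (h1.trans h2)).trans_eq ?_)
      rw [exp_add, exp_log hMp, mul_comm]
  have hAc : A.card ≤ (condClass x w).card :=
    Finset.card_le_card_of_injOn Subtype.val (fun a ha => (Finset.mem_filter.mp ha).2)
      Subtype.val_injective.injOn
  have hBc : B.card ≤ (condClass y w).card :=
    Finset.card_le_card_of_injOn Subtype.val (fun a ha => (Finset.mem_filter.mp ha).2)
      Subtype.val_injective.injOn
  have hT : ∀ z' ∈ condClass z w, z' ∈ typeClass n T := by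
    intro z' hz'
    rw [mem_condClass] at hz'
    rw [mem_typeClass_iff hn1] at hu ⊢
    intro p
    rw [← hu p]
    exact congrArg Nat.cast (count_comp_congr hz' Prod.fst p)
  have hedge : (condClass z w).card ≤ (edges T A B).card := by
    refine Finset.card_le_card_of_injOn (fun z' => if h : z' ∈ typeClass n T then
      (⟨fun i => (z' i).1, fst_mem_typeClass hn1 h⟩, ⟨fun i => (z' i).2, snd_mem_typeClass hn1 h⟩)
      else (⟨x, fst_mem_typeClass hn1 hu⟩, ⟨y, snd_mem_typeClass hn1 hu⟩)) ?_ ?_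
    · intro z' hz'
      have hz : z' ∈ condClass z w := hz'
      simp only [hT z' hz, dif_pos, edges, Finset.coe_filter, Set.mem_ofPred_eq,
        Finset.mem_product, A, B, Finset.mem_filter, Finset.mem_univ, true_and]
      rw [mem_condClass] at hz
      refine ⟨⟨?_, ?_⟩, trivial⟩
      · rw [mem_condClass]
        exact fun p => count_comp_congr hz (fun t => (t.1.1, t.2)) p
      · rw [mem_condClass]
        exact fun p => count_comp_congr hz (fun t => (t.1.2, t.2)) p
    · intro z' hz' z'' hz'' h
      simp only [hT z' hz', hT z'' hz'', dif_pos, Prod.mk.injEq, Subtype.mk.injEq] at h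
      funext i
      exact Prod.ext (congrFun h.1 i) (congrFun h.2 i)
  have hc : 0 < (condClass z w).card :=
    Finset.card_pos.mpr ⟨z, mem_condClass.mpr fun _ => rfl⟩
  have hAle : (A.card : ℝ) ≤ exp δ₁ * M₁ :=
    (Nat.cast_le.mpr hAc).trans (hbound hM₁ hX h₁)
  have hBle : (B.card : ℝ) ≤ exp δ₂ * M₂ :=
    (Nat.cast_le.mpr hBc).trans (hbound hM₂ hY h₂)
  obtain ⟨hpos, hle⟩ := log_card_edges_le hM₁ hM₂ hM₁' hM₂' A B hδ₁ hδ₂ hAle hBle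
    (Finset.card_pos.mp (hc.trans_le hedge))
  refine ⟨hpos, le_trans ?_ hle⟩
  have h3 := log_le_log (by exact_mod_cast hc) (Nat.cast_le (α := ℝ).mpr hedge)
  linarith

/-- Rounding an optimal triple to the block length `n` moves every cell by at most `1 / n`; the changes
of the three conditional entropies, together with the counting loss `(n + 1) ^ (|X| |Y| |W|)`, add up
to `errorTerm`. -/
lemma log_maxDensity_ge (hcard : 2 * (Fintype.card X * Fintype.card Y + 2) *
      (Fintype.card X * Fintype.card Y) ≤ n) (hn : 1 ≤ n) {T : X × Y → ℝ} (hT : IsNType n T)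
    {M₁ M₂ : ℕ} (hM₁ : 1 ≤ M₁) (hM₂ : 1 ≤ M₂)
    (hM₁' : M₁ ≤ (typeClass n (margX T)).ncard) (hM₂' : M₂ ≤ (typeClass n (margY T)).ncard)
    {R₁ R₂ : ℝ} (hR₁ : log M₁ = n * R₁) (hR₂ : log M₂ = n * R₂) :
    0 < maxDensity n T M₁ M₂ ∧ n * FStar T R₁ R₂ - n * R₁ - n * R₂ -
      n * errorTerm (Fintype.card X) (Fintype.card Y) n ≤ log (maxDensity n T M₁ M₂) := by
  classical
  have hn' : (0 : ℝ) < n := by positivity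
  have hTs := hT.mem_stdSimplex hn
  have h₁ : 0 ≤ R₁ := nonneg_of_mul_nonneg_right ((log_natCast_nonneg _).trans_eq hR₁) hn'
  have h₂ : 0 ≤ R₂ := nonneg_of_mul_nonneg_right ((log_natCast_nonneg _).trans_eq hR₂) hn'
  set a := Fintype.card X with ha
  set b := Fintype.card Y with hb
  have hmem : FStar T R₁ R₂ ∈ entropyValues T R₁ R₂ (a * b + 2) :=
    (isGreatest_FStar hTs h₁ h₂).2.1
  obtain ⟨P, hP, hPF⟩ := hmem
  have hX : Nonempty X ∧ Nonempty Y := by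
    obtain ⟨z, -⟩ := hT
    exact ⟨⟨(z ⟨0, hn⟩).1⟩, ⟨(z ⟨0, hn⟩).2⟩⟩
  have ha1 : 1 ≤ a := Fintype.card_pos_iff.mpr hX.1
  have hb1 : 1 ≤ b := Fintype.card_pos_iff.mpr hX.2
  have hab1 : 1 ≤ a * b := Nat.mul_pos ha1 hb1
  have hn6 : 6 * (a * b) ≤ n := by nlinarith
  obtain ⟨z₀, hz₀⟩ := hT
  have hz₀' := (mem_typeClass_iff hn).mp hz₀
  obtain ⟨hP0, -, hPT, -, -⟩ := feasible_iff.mp hP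
  choose r hr hr1 using fun x y => exists_nat_round (fun w => n * P (x, y, w))
    (fun w => mul_nonneg hn'.le (hP0 x y w)) (count z₀ (x, y))
    (by rw [← Finset.mul_sum, hPT, hz₀'])
  have hrn : ∑ t : X × Y × Fin (a * b + 2), r t.1 t.2.1 t.2.2 = n := by
    simp only [Fintype.sum_prod_type, hr]
    rw [← Fintype.sum_prod_type' fun x y => count z₀ (x, y)]
    exact sum_count z₀
  obtain ⟨u, hu⟩ := exists_count_eq (fun t : X × Y × Fin (a * b + 2) => r t.1 t.2.1 t.2.2) hrn
  have huT : (fun i => ((u i).1, (u i).2.1)) ∈ typeClass n T := by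
    rw [mem_typeClass_iff hn]
    intro p
    rw [← hz₀', ← hr]
    have := count_map_fst (fun i => (((u i).1, (u i).2.1), (u i).2.2)) p
    rw [this]
    congr 1
    refine Finset.sum_congr rfl fun w _ => ?_
    refine (count_comp_injective
      (f := fun t : X × Y × Fin (a * b + 2) => ((t.1, t.2.1), t.2.2))
      (by rintro ⟨a, b, c⟩ ⟨a', b', c'⟩ h; simp_all) u (p.1, p.2, w)).trans ?_
    exact hu (p.1, p.2, w)
  -- the normalised counts
  let Q : X → Y → Fin (a * b + 2) → ℝ := fun x y w => r x y w / n
  have hQ0 : ∀ x y w, 0 ≤ Q x y w := fun x y w => by positivity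
  have hrQ : ∀ x y w, (count u (x, y, w) : ℝ) = n * Q x y w := fun x y w => by
    rw [hu]
    simp only [Q]
    field_simp
  have hPQ : ∀ x y w, |P (x, y, w) - Q x y w| ≤ 1 / n := by
    intro x y w
    have e : P (x, y, w) - Q x y w = -((r x y w : ℝ) - n * P (x, y, w)) / n := by
      simp only [Q]
      field_simp
      ring
    rw [e, abs_div, abs_neg, abs_of_pos hn']
    exact div_le_div_of_nonneg_right (hr1 x y w) hn'.le
  have hPX : ∀ x w, |∑ y, P (x, y, w) - ∑ y, Q x y w| ≤ b / n := by
    intro x w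
    rw [← Finset.sum_sub_distrib]
    refine (Finset.abs_sum_le_sum_abs _ _).trans
      ((Finset.sum_le_card_nsmul _ _ _ fun y _ => hPQ x y w).trans_eq ?_)
    rw [Finset.card_univ, nsmul_eq_mul, ← hb]
    ring
  have hPY : ∀ y w, |∑ x, P (x, y, w) - ∑ x, Q x y w| ≤ a / n := by
    intro y w
    rw [← Finset.sum_sub_distrib]
    refine (Finset.abs_sum_le_sum_abs _ _).trans
      ((Finset.sum_le_card_nsmul _ _ _ fun x _ => hPQ x y w).trans_eq ?_)
    rw [Finset.card_univ, nsmul_eq_mul, ← ha]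
    ring
  have hPW : ∀ w, |∑ x, ∑ y, P (x, y, w) - ∑ x, ∑ y, Q x y w| ≤ a * b / n := by
    intro w
    rw [← Finset.sum_sub_distrib]
    refine (Finset.abs_sum_le_sum_abs _ _).trans
      ((Finset.sum_le_card_nsmul _ _ _ fun x _ => hPX x w).trans_eq ?_)
    rw [Finset.card_univ, nsmul_eq_mul, ← ha]
    ring
  have hP1 : ∀ w, ∑ x, ∑ y, P (x, y, w) ≤ 1 := by
    intro w
    rw [← hTs.2, Fintype.sum_prod_type]
    refine Finset.sum_le_sum fun x _ => Finset.sum_le_sum fun y _ => ?_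
    rw [← hPT]
    exact Finset.single_le_sum (f := fun w => P (x, y, w)) (fun w _ => hP0 x y w)
      (Finset.mem_univ w)
  have hQ1 : ∀ w, ∑ x, ∑ y, Q x y w ≤ 1 := by
    intro w
    simp only [Q, ← Finset.sum_div]
    rw [div_le_one hn']
    have hsum : ∑ x, ∑ y, ∑ w, r x y w = n := by
      simpa only [Fintype.sum_prod_type] using hrn
    conv_rhs => rw [← hsum]
    push_cast
    exact Finset.sum_le_sum fun x _ => Finset.sum_le_sum fun y _ =>
      Finset.single_le_sum (f := fun w => (r x y w : ℝ)) (fun w _ => Nat.cast_nonneg _)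
        (Finset.mem_univ w)
  have hsmall : (a * b : ℝ) / n ≤ exp (-1) := by
    have h6 : (6 : ℝ) * (a * b) ≤ n := by exact_mod_cast hn6
    have he : (1 : ℝ) / 6 ≤ exp (-1) := by
      rw [exp_neg, ← one_div]
      exact one_div_le_one_div_of_le (exp_pos 1) (by linarith [exp_one_lt_d9])
    refine le_trans ?_ he
    rw [div_le_iff₀ hn']
    linarith
  have ha1' : (1 : ℝ) ≤ a := by exact_mod_cast ha1
  have hb1' : (1 : ℝ) ≤ b := by exact_mod_cast hb1
  have hle : ∀ {c : ℝ}, c ≤ a * b → c / n ≤ exp (-1) := fun hc =>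
    (div_le_div_of_nonneg_right hc hn'.le).trans hsmall
  have hsX : (b : ℝ) / n ≤ exp (-1) := hle (by nlinarith)
  have hsY : (a : ℝ) / n ≤ exp (-1) := hle (by nlinarith)
  have hsZ : (1 : ℝ) / n ≤ exp (-1) := hle (by nlinarith)
  have hη : ∀ {c : ℝ}, 0 ≤ c → c / n ≤ exp (-1) → 0 ≤ negMulLog (c / n) := fun hc h =>
    negMulLog_nonneg (div_nonneg hc hn'.le) (h.trans (by rw [exp_le_one_iff]; norm_num))
  set m : ℝ := a * b + 2 with hm
  have hm0 : 0 ≤ m := by positivity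
  have hmc : (Fintype.card (Fin (a * b + 2)) : ℝ) = m := by
    rw [Fintype.card_fin]
    push_cast
    rfl
  have hcX := abs_condEntropy_sub_le
    (P := fun x w => ∑ y, P (x, y, w)) (Q := fun x w => ∑ y, Q x y w)
    (fun x w => Finset.sum_nonneg fun y _ => hP0 x y w)
    (fun x w => Finset.sum_nonneg fun y _ => hQ0 x y w) hP1 hQ1 hsX hsmall hPX hPW
  have hcY := abs_condEntropy_sub_le
    (P := fun y w => ∑ x, P (x, y, w)) (Q := fun y w => ∑ x, Q x y w)
    (fun y w => Finset.sum_nonneg fun x _ => hP0 x y w)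
    (fun y w => Finset.sum_nonneg fun x _ => hQ0 x y w)
    (fun w => by rw [Finset.sum_comm]; exact hP1 w)
    (fun w => by rw [Finset.sum_comm]; exact hQ1 w) hsY hsmall hPY
    (fun w => by rw [Finset.sum_comm, Finset.sum_comm (f := fun y x => Q x y w)]; exact hPW w)
  have hcXY := abs_condEntropy_sub_le
    (P := fun (z : X × Y) w => P (z.1, z.2, w)) (Q := fun (z : X × Y) w => Q z.1 z.2 w)
    (fun z w => hP0 z.1 z.2 w) (fun z w => hQ0 z.1 z.2 w)
    (fun w => by rw [Fintype.sum_prod_type]; exact hP1 w)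
    (fun w => by rw [Fintype.sum_prod_type]; exact hQ1 w) hsZ hsmall
    (fun z w => hPQ z.1 z.2 w)
    (fun w => by simp only [Fintype.sum_prod_type]; exact hPW w)
  rw [hmc, ← ha, abs_le] at hcX
  rw [hmc, ← hb, abs_le] at hcY
  rw [hmc, Fintype.card_prod, ← ha, ← hb, Nat.cast_mul, abs_le, hPF] at hcXY
  set ΔX := a * m * negMulLog (b / n) + m * negMulLog (a * b / n) with hΔX
  set ΔY := b * m * negMulLog (a / n) + m * negMulLog (a * b / n) with hΔY
  set ΔXY := a * b * m * negMulLog (1 / n) + m * negMulLog (a * b / n) with hΔXY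
  have hηW := hη (by positivity) hsmall
  have hΔX0 : 0 ≤ ΔX := by
    have := hη (by positivity) hsX
    positivity
  have hΔY0 : 0 ≤ ΔY := by
    have := hη (by positivity) hsY
    positivity
  have hHX : condEntropy (fun x w => ∑ y, (count u (x, y, w) : ℝ)) =
      n * condEntropy (fun x w => ∑ y, Q x y w) := by
    simp only [hrQ, ← Finset.mul_sum]
    exact condEntropy_const_mul hn'.le fun x w => Finset.sum_nonneg fun y _ => hQ0 x y w
  have hHY : condEntropy (fun y w => ∑ x, (count u (x, y, w) : ℝ)) =
      n * condEntropy (fun y w => ∑ x, Q x y w) := by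
    simp only [hrQ, ← Finset.mul_sum]
    exact condEntropy_const_mul hn'.le fun y w => Finset.sum_nonneg fun x _ => hQ0 x y w
  have hHXY : condEntropy (fun (z : X × Y) w => (count u (z.1, z.2, w) : ℝ)) =
      n * condEntropy (fun (z : X × Y) w => Q z.1 z.2 w) := by
    simp only [hrQ]
    exact condEntropy_const_mul hn'.le fun z w => hQ0 z.1 z.2 w
  obtain ⟨hpos, hmain⟩ := log_maxDensity_ge_of_sequence (by nlinarith) hM₁ hM₂ hM₁' hM₂' u huT
    (δ₁ := n * ΔX) (δ₂ := n * ΔY) (by positivity) (by positivity)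
    (by
      rw [hHX, hR₁, ← mul_add]
      refine mul_le_mul_of_nonneg_left ?_ hn'.le
      linarith [hcX.1, hP.2.2.1])
    (by
      rw [hHY, hR₂, ← mul_add]
      refine mul_le_mul_of_nonneg_left ?_ hn'.le
      linarith [hcY.1, hP.2.2.2])
  refine ⟨hpos, le_trans ?_ hmain⟩
  rw [hHXY, hR₁, hR₂]
  have hF := mul_le_mul_of_nonneg_left hcXY.2 hn'.le
  have ha0 : (a : ℝ) ≠ 0 := by positivity
  have hb0 : (b : ℝ) ≠ 0 := by positivity
  have herr : (n : ℝ) * errorTerm a b n =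
      a * b * m * log (n + 1) + n * ΔX + n * ΔY + n * ΔXY := by
    have e1 : log (((n : ℝ) + 1) * (n : ℝ) ^ 6 / ((a : ℝ) ^ 4 * (b : ℝ) ^ 4)) =
        log (n + 1) + 6 * log n - (4 * log a + 4 * log b) := by
      rw [log_div (by positivity) (by positivity), log_mul (by positivity) (by positivity),
        log_mul (by positivity) (by positivity), log_pow, log_pow, log_pow]
      norm_num
    rw [errorTerm, e1, hΔX, hΔY, hΔXY]
    simp only [negMulLog]
    rw [log_div hb0 hn'.ne', log_div ha0 hn'.ne', log_div one_ne_zero hn'.ne',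
      log_div (by positivity) hn'.ne', log_mul ha0 hb0, log_one, hm]
    field_simp
    ring
  have hcast : ((a * b + 2 : ℕ) : ℝ) = m := by
    push_cast
    rfl
  rw [herr, hcast]
  linarith

end

/-! ### The exponent -/

section

variable {X Y : Type*} [Fintype X] [Fintype Y] {n : ℕ}

theorem EStar_le_exponent_and_le (hcard : 2 * (Fintype.card X * Fintype.card Y + 2) *
      (Fintype.card X * Fintype.card Y) ≤ n) (hn : 1 ≤ n) {T : X × Y → ℝ} (hT : IsNType n T)
    {R₁ R₂ : ℝ} (hR₁ : R₁ ∈ rates n (margX T)) (hR₂ : R₂ ∈ rates n (margY T)) :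
    EStar T R₁ R₂ ≤ exponent n T R₁ R₂ ∧ exponent n T R₁ R₂ ≤
      EStar T R₁ R₂ + errorTerm (Fintype.card X) (Fintype.card Y) n := by
  have hn' : (0 : ℝ) < n := by positivity
  obtain ⟨M₁, hM₁, hM₁', h₁⟩ := hR₁
  obtain ⟨M₂, hM₂, hM₂', h₂⟩ := hR₂
  have h₁' : log M₁ = n * R₁ := by
    rw [h₁]
    field_simp
  have h₂' : log M₂ = n * R₂ := by
    rw [h₂]
    field_simp
  have e₁ : exp (n * R₁) = M₁ := by
    rw [← h₁', exp_log (by exact_mod_cast hM₁)]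
  have e₂ : exp (n * R₂) = M₂ := by
    rw [← h₂', exp_log (by exact_mod_cast hM₂)]
  obtain ⟨hpos, hge⟩ := log_maxDensity_ge hcard hn hT hM₁ hM₂ hM₁' hM₂' h₁' h₂'
  have hle := log_maxDensity_le hn hM₁ hM₂ h₁' h₂' hpos
  have hexp : exponent n T R₁ R₂ = -log (maxDensity n T M₁ M₂) / n := by
    rw [exponent, e₁, e₂]
    ring
  rw [hexp, EStar]
  constructor
  · rw [le_div_iff₀ hn']
    linarith
  · rw [div_le_iff₀ hn']
    linarith

/-- Concatenating `k` sequences of the same type. -/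
lemma ncard_typeClass_pow_le {A : Type*} [Finite A] (k : ℕ) (hk : 1 ≤ k) (hn : 1 ≤ n) (S : A → ℝ) :
    (typeClass n S).ncard ^ k ≤ (typeClass (k * n) S).ncard := by
  classical
  have : Fintype A := Fintype.ofFinite A
  have hkn : 1 ≤ k * n := Nat.mul_pos hk hn
  let cat : (Fin k → typeClass n S) → (Fin (k * n) → A) := fun f i =>
    (f (finProdFinEquiv.symm i).1).1 (finProdFinEquiv.symm i).2
  have hmem : ∀ f, cat f ∈ typeClass (k * n) S := by
    intro f
    rw [mem_typeClass_iff hkn]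
    intro a
    have e : (count (cat f) a : ℝ) = ∑ j, (count (f j).1 a : ℝ) := by
      simp only [count, Finset.card_filter, Nat.cast_sum]
      rw [← Fintype.sum_prod_type' fun j i => ((if (f j).1 i = a then 1 else 0 : ℕ) : ℝ),
        ← finProdFinEquiv.sum_comp]
      simp only [cat, Equiv.symm_apply_apply]
    rw [e, Finset.sum_congr rfl fun j _ => (mem_typeClass_iff hn).mp (f j).2 a]
    simp only [Finset.sum_const, Finset.card_univ, Fintype.card_fin, nsmul_eq_mul]
    push_cast
    ring
  have hinj : Function.Injective fun f => (⟨cat f, hmem f⟩ : typeClass (k * n) S) := by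
    intro f g h
    have h' : cat f = cat g := congrArg Subtype.val h
    funext j
    apply Subtype.ext
    funext i
    have := congrFun h' (finProdFinEquiv (j, i))
    simpa only [cat, Equiv.symm_apply_apply] using this
  have := Nat.card_le_card_of_injective _ hinj
  rwa [Nat.card_fun, Nat.card_fin, Nat.card_coe_set_eq, Nat.card_coe_set_eq] at this

lemma IsNType.mul {A : Type*} [Finite A] {S : A → ℝ} (hn : 1 ≤ n) (hS : IsNType n S) {k : ℕ}
    (hk : 1 ≤ k) : IsNType (k * n) S := by
  have h1 : 0 < (typeClass n S).ncard := (Set.ncard_pos (Set.toFinite _)).mpr hS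
  have h2 : 0 < (typeClass (k * n) S).ncard :=
    (pow_pos h1 k).trans_le (ncard_typeClass_pow_le k hk hn S)
  exact (Set.ncard_pos (Set.toFinite _)).mp h2

lemma rates_subset_mul {A : Type*} [Finite A] {S : A → ℝ} (hn : 1 ≤ n) {k : ℕ} (hk : 1 ≤ k) :
    rates n S ⊆ rates (k * n) S := by
  rintro _ ⟨M, hM, hM', rfl⟩
  refine ⟨M ^ k, Nat.one_le_pow _ _ hM,
    (Nat.pow_le_pow_left hM' k).trans (ncard_typeClass_pow_le k hk hn S), ?_⟩
  have hk' : (k : ℝ) ≠ 0 := by positivity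
  have hn' : (n : ℝ) ≠ 0 := by positivity
  push_cast
  rw [log_pow]
  field_simp

/-! ### The error term -/

lemma errorTerm_isBigO {a b : ℕ} (ha : 1 ≤ a) (hb : 1 ≤ b) :
    (fun N : ℕ => errorTerm a b N) =O[atTop] fun N : ℕ => log N / N := by
  have ha' : (0 : ℝ) < a := by exact_mod_cast ha
  have hb' : (0 : ℝ) < b := by exact_mod_cast hb
  set K : ℝ := ((a : ℝ) * b + 2) * a * b with hK
  set D : ℝ := log ((a : ℝ) ^ 4 * (b : ℝ) ^ 4) with hD
  have h2 : 0 < log (2 : ℝ) := log_pos one_lt_two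
  refine IsBigO.of_bound (K * (8 + |D| / log 2)) ?_
  filter_upwards [eventually_ge_atTop 2] with N hN
  have hN' : (2 : ℝ) ≤ N := by exact_mod_cast hN
  have hN0 : (0 : ℝ) < N := by linarith
  have hlog : log 2 ≤ log (N : ℝ) := log_le_log two_pos hN'
  have hlog1 : log ((N : ℝ) + 1) ≤ 2 * log N := by
    have : 2 * log (N : ℝ) = log ((N : ℝ) ^ 2) := by
      rw [log_pow]
      norm_num
    rw [this]
    exact log_le_log (by positivity) (by nlinarith)
  have hlog0 : 0 ≤ log ((N : ℝ) + 1) := log_nonneg (by linarith)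
  have hDle : |D| ≤ |D| / log 2 * log N := by
    rw [div_mul_eq_mul_div, le_div_iff₀ h2]
    exact mul_le_mul_of_nonneg_left hlog (abs_nonneg D)
  have habs : |log (((N : ℝ) + 1) * (N : ℝ) ^ 6 / ((a : ℝ) ^ 4 * (b : ℝ) ^ 4))| ≤
      (8 + |D| / log 2) * log N := by
    rw [log_div (by positivity) (by positivity), log_mul (by positivity) (by positivity), log_pow,
      ← hD, abs_le]
    push_cast
    constructor <;> linarith [le_abs_self D, neg_abs_le D]
  rw [errorTerm, norm_mul, Real.norm_eq_abs, Real.norm_eq_abs, Real.norm_eq_abs, ← hK,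
    abs_of_nonneg (a := K / N) (by positivity),
    abs_of_nonneg (a := log (N : ℝ) / N) (div_nonneg (by linarith) hN0.le)]
  refine (mul_le_mul_of_nonneg_left habs (by positivity)).trans_eq ?_
  ring

lemma tendsto_errorTerm {a b : ℕ} (ha : 1 ≤ a) (hb : 1 ≤ b) :
    Tendsto (fun N : ℕ => errorTerm a b N) atTop (𝓝 0) := by
  refine (errorTerm_isBigO ha hb).trans_tendsto ?_
  exact (isLittleO_log_id_atTop.comp_tendsto tendsto_natCast_atTop_atTop).tendsto_div_nhds_zero

theorem tendsto_exponent (hn : 1 ≤ n) {T : X × Y → ℝ} (hT : IsNType n T)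
    (hX : 1 ≤ Fintype.card X) (hY : 1 ≤ Fintype.card Y)
    {R₁ R₂ : ℝ} (hR₁ : R₁ ∈ rates n (margX T)) (hR₂ : R₂ ∈ rates n (margY T)) :
    Tendsto (fun k : ℕ => exponent (k * n) T R₁ R₂) atTop (𝓝 (EStar T R₁ R₂)) := by
  have hkn : Tendsto (fun k : ℕ => k * n) atTop atTop := tendsto_id.atTop_mul_const' hn
  have hlim : Tendsto (fun k : ℕ => EStar T R₁ R₂ +
      errorTerm (Fintype.card X) (Fintype.card Y) (k * n)) atTop (𝓝 (EStar T R₁ R₂)) := by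
    simpa using ((tendsto_errorTerm hX hY).comp hkn).const_add (EStar T R₁ R₂)
  have hb : ∀ᶠ k : ℕ in atTop, EStar T R₁ R₂ ≤ exponent (k * n) T R₁ R₂ ∧
      exponent (k * n) T R₁ R₂ ≤
        EStar T R₁ R₂ + errorTerm (Fintype.card X) (Fintype.card Y) (k * n) := by
    filter_upwards [eventually_ge_atTop 1, hkn.eventually_ge_atTop
      (2 * (Fintype.card X * Fintype.card Y + 2) * (Fintype.card X * Fintype.card Y))]
      with k hk hle
    exact EStar_le_exponent_and_le hle (Nat.mul_pos hk hn) (hT.mul hn hk)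
      (rates_subset_mul hn hk hR₁) (rates_subset_mul hn hk hR₂)
  exact tendsto_of_tendsto_of_tendsto_of_le_of_le' tendsto_const_nhds hlim
    (hb.mono fun _ h => h.1) (hb.mono fun _ h => h.2)

end

end TypeGraph

theorem theorem1 {X Y : Type*} [Fintype X] [Fintype Y]
    (T : X × Y → ℝ) (n : ℕ) (hn : 1 ≤ n) (hT : TypeGraph.IsNType n T) :
    -- two-sided bound on the exponent at finite length
    (2 * (Fintype.card X * Fintype.card Y + 2) * (Fintype.card X * Fintype.card Y) ≤ n →
      ∀ R₁ ∈ TypeGraph.rates n (TypeGraph.margX T),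
      ∀ R₂ ∈ TypeGraph.rates n (TypeGraph.margY T),
        TypeGraph.EStar T R₁ R₂ ≤ TypeGraph.exponent n T R₁ R₂ ∧
        TypeGraph.exponent n T R₁ R₂ ≤
          TypeGraph.EStar T R₁ R₂ +
            TypeGraph.errorTerm (Fintype.card X) (Fintype.card Y) n) ∧
    -- order of the error term
    ((fun N : ℕ => TypeGraph.errorTerm (Fintype.card X) (Fintype.card Y) N) =O[atTop]
      fun N : ℕ => Real.log N / N) ∧
    -- the asymptotic exponent
    (∀ R₁ ∈ TypeGraph.rates n (TypeGraph.margX T),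
      ∀ R₂ ∈ TypeGraph.rates n (TypeGraph.margY T),
        Tendsto (fun k : ℕ => TypeGraph.exponent (k * n) T R₁ R₂) atTop
          (𝓝 (TypeGraph.EStar T R₁ R₂))) ∧
    -- the maximum defining `FStar` is attained, with a small alphabet
    (∀ R₁ R₂ : ℝ, 0 ≤ R₁ → 0 ≤ R₂ →
      IsGreatest (⋃ m : ℕ, TypeGraph.entropyValues T R₁ R₂ m) (TypeGraph.FStar T R₁ R₂) ∧
      ∃ m : ℕ, m ≤ Fintype.card X * Fintype.card Y + 2 ∧
        IsGreatest (TypeGraph.entropyValues T R₁ R₂ m) (TypeGraph.FStar T R₁ R₂)) := by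
  have hX : 1 ≤ Fintype.card X := by
    obtain ⟨z, -⟩ := hT
    exact Fintype.card_pos_iff.mpr ⟨(z ⟨0, hn⟩).1⟩
  have hY : 1 ≤ Fintype.card Y := by
    obtain ⟨z, -⟩ := hT
    exact Fintype.card_pos_iff.mpr ⟨(z ⟨0, hn⟩).2⟩
  refine ⟨fun hcard R₁ hR₁ R₂ hR₂ => TypeGraph.EStar_le_exponent_and_le hcard hn hT hR₁ hR₂,
    TypeGraph.errorTerm_isBigO hX hY,
    fun R₁ hR₁ R₂ hR₂ => TypeGraph.tendsto_exponent hn hT hX hY hR₁ hR₂, fun R₁ R₂ h₁ h₂ => ?_⟩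
  obtain ⟨hU, hm⟩ := TypeGraph.isGreatest_FStar (hT.mem_stdSimplex hn) h₁ h₂
  exact ⟨hU, _, le_rfl, hm⟩
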